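/- Let $S\ge 0$ and $h\ge 0$ be integers, $\mathbb H=(L^2([0,1]))^S=\mathbb R^S\otimes L^2([0,1])$, and let $(X_n)_{n\in\mathbb Z}$ be a mean-zero sequence of random elements of $\mathbb H$ that is $L^4$-$m$-approximable: $E\|X_n\|^4<\infty$; $X_n=f(u_n,u_{n-1},\dots)$ a.s. for iid random elements $u_n$ of a measurable space and a measurable $f$; and $\sum_{M\ge1}\big(E\|X_n-X_{n,M}\|^4\big)^{1/4}<\infty$ for every $n$, where $X_{n,M}=f(u_n,\dots,u_{n-M},u^*_{n-M-1},u^*_{n-M-2},\dots)$ and $(u^*_n)$ is an independent copy of $(u_n)$. For $x,y\in\mathbb H$ let $x\otimes y$ be the operator $z\mapsto\langle y,z\rangle x$, and let $C=E[X_0\otimes X_h]$ and, for $N>h$, $\widehat C=\frac1{N-h}\sum_{n=1}^{N-h}X_n\otimes X_{n+h}$. For an operator $T$ on $\mathbb H$ with blocks $T_{ss'}$ (operators on $L^2([0,1])$, $1\le s,s'\le S$), the partial traces are $\mathrm{Tr}_1(T)=\sum_s T_{ss}$ and the $S\times S$ matrix $\mathrm{Tr}_2(T)=(\mathrm{Tr}(T_{ss'}))_{s,s'}$;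 for an $S\times S$ matrix $A$ and an operator $B$ on $L^2([0,1])$, $A\widetilde\otimes B$ is the operator on $\mathbb H$ with $(A\widetilde\otimes B)(a\otimes v)=(Aa)\otimes(Bv)$. Assume $\mathrm{Tr}(C)\ne0$ and put $C_1=\mathrm{Tr}_2(C)/\mathrm{Tr}(C)$, $C_2=\mathrm{Tr}_1(C)$; define $\widehat C_1,\widehat C_2$ in the same way from $\widehat C$ (with $\widehat C_1=0$ if $\mathrm{Tr}(\widehat C)=0$). Let $\Delta=C_1\widetilde\otimes C_2-C$ and $\widehat T=\widehat T_N=N\|\widehat C_1\widetilde\otimes\widehat C_2-\widehat C\|^2$, where $\|\cdot\|$ is the Hilbert–Schmidt norm. If $\Delta\ne0$, then $\Delta$ and $\widehat C_1\widetilde\otimes\widehat C_2-\widehat C$ are Hilbert–Schmidt operators and, as $N\to\infty$, $$\widehat T=N\|\Delta\|^2+O_P(N^{1/2}),$$ and $\widehat T\to\infty$ in probability, that is, $P(\widehat T\le K)\to0$ for every real $K$. Hence the test that rejects when $\widehat T$ exceeds a critical value $q_N$ (possibly random) is consistent: $P(\widehat T>q_N)\to1$ whenever $q_N=O_P(1)$.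 -/

import Mathlib

open MeasureTheory ProbabilityTheory Filter Topology
open scoped ENNReal

universe w

namespace SepTest

noncomputable section

/-- The space `L²([0,1])` of (classes of) square integrable real functions on `[0,1]`. -/
abbrev L2I : Type := Lp ℝ 2 (volume : Measure unitInterval)

/-- The Hilbert space `(L²([0,1]))^S = ℝ^S ⊗ L²([0,1])` of panels of `S` curves, with inner
product `⟪x, y⟫ = ∑ s, ∫ x_s y_s`. -/
abbrev Panel (S : ℕ) : Type := PiLp 2 (fun _ : Fin S => L2I)

/-! ### Traces and Hilbert-Schmidt norm of operators on a real Hilbert space -/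

section Operators

variable {E : Type*} [NormedAddCommGroup E] [InnerProductSpace ℝ E] [CompleteSpace E]

variable (E) in
/-- The index set of an orthonormal (Hilbert) basis of `E`, chosen once and for all. -/
def onbIndex : Set E := (exists_hilbertBasis ℝ E).choose

variable (E) in
/-- An orthonormal (Hilbert) basis of `E`, chosen once and for all. -/
def onb : HilbertBasis (onbIndex E) ℝ E := (exists_hilbertBasis ℝ E).choose_spec.choose

/-- The trace `∑ i, ⟪T e_i, e_i⟫` (which, for trace class operators, does not depend on the
orthonormal basis). -/
def opTrace (T : E →L[ℝ] E) : ℝ := ∑' i, inner ℝ (T (onb E i)) (onb E i)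

/-- `T` is a Hilbert-Schmidt operator: `∑ i, ‖T e_i‖² < ∞` (in one, equivalently in every,
orthonormal basis). -/
def IsHilbertSchmidt (T : E →L[ℝ] E) : Prop := Summable fun i => ‖T (onb E i)‖ ^ 2

/-- The Hilbert-Schmidt norm `(∑ i, ‖T e_i‖²)^{1/2}` of a Hilbert-Schmidt operator. -/
def hsNorm (T : E →L[ℝ] E) : ℝ := √(∑' i, ‖T (onb E i)‖ ^ 2)

end Operators

/-! ### Operators on panels: tensor products and partial traces -/

variable {S : ℕ}

/-- The tensor `a ⊗ v` of `a ∈ ℝ^S` and `v ∈ L²([0,1])`: the panel `(a_s v)_s`. -/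
def tmul (a : Fin S → ℝ) (v : L2I) : Panel S := WithLp.toLp 2 fun s => a s • v

/-- The `s`-th coordinate map `(L²)^S → L²`. -/
def coordL (s : Fin S) : Panel S →L[ℝ] L2I := PiLp.proj 2 (fun _ : Fin S => L2I) s

/-- The inclusion `L² → (L²)^S` as the `s`-th coordinate, `v ↦ e_s ⊗ v`. -/
def inclL (s : Fin S) : L2I →L[ℝ] Panel S :=
  (PiLp.continuousLinearEquiv 2 ℝ (fun _ : Fin S => L2I)).symm.toContinuousLinearMap ∘L
    ContinuousLinearMap.single ℝ (fun _ : Fin S => L2I) s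

/-- The block `T_{s s'}`, an operator on `L²([0,1])`, of an operator `T` on `(L²)^S`. -/
def block (T : Panel S →L[ℝ] Panel S) (s s' : Fin S) : L2I →L[ℝ] L2I :=
  coordL s ∘L T ∘L inclL s'

/-- The operator `A ⊗̃ B` on `ℝ^S ⊗ L²([0,1])`, for an `S × S` matrix `A` and an operator `B`
on `L²([0,1])`; its blocks are `A_{s s'} B`. -/
def tensorOp (A : Matrix (Fin S) (Fin S) ℝ) (B : L2I →L[ℝ] L2I) : Panel S →L[ℝ] Panel S :=
  ∑ s, ∑ s', A s s' • (inclL s ∘L B ∘L coordL s')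

/-- The partial trace `Tr₁`, over the factor `ℝ^S`: an operator on `L²([0,1])`. -/
def partialTrace₁ (T : Panel S →L[ℝ] Panel S) : L2I →L[ℝ] L2I := ∑ s, block T s s

/-- The partial trace `Tr₂`, over the factor `L²([0,1])`: an `S × S` matrix. -/
def partialTrace₂ (T : Panel S →L[ℝ] Panel S) : Matrix (Fin S) (Fin S) ℝ :=
  Matrix.of fun s s' => opTrace (block T s s')

theorem tensorOp_apply (A : Matrix (Fin S) (Fin S) ℝ) (B : L2I →L[ℝ] L2I) (x : Panel S)
    (s : Fin S) : tensorOp A B x s = ∑ s', A s s' • B (x s') := by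
  simp [tensorOp, inclL, coordL, Pi.single_apply, Finset.sum_apply, WithLp.ofLp_sum]

/-- The defining property `(A ⊗̃ B) (a ⊗ v) = (A a) ⊗ (B v)`. -/
theorem tensorOp_tmul (A : Matrix (Fin S) (Fin S) ℝ) (B : L2I →L[ℝ] L2I) (a : Fin S → ℝ)
    (v : L2I) : tensorOp A B (tmul a v) = tmul (A.mulVec a) (B v) := by
  ext1 s
  rw [tensorOp_apply]
  simp [tmul, Matrix.mulVec, dotProduct, Finset.sum_smul, smul_smul]

theorem block_tensorOp (A : Matrix (Fin S) (Fin S) ℝ) (B : L2I →L[ℝ] L2I) (s s' : Fin S) :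
    block (tensorOp A B) s s' = A s s' • B := by
  ext1 v
  have h : block (tensorOp A B) s s' v = tensorOp A B (inclL s' v) s := rfl
  rw [h, tensorOp_apply]
  rw [Finset.sum_eq_single s'] <;> simp +contextual [inclL]

/-- `Tr₁ (A ⊗̃ B) = Tr(A) B`. -/
theorem partialTrace₁_tensorOp (A : Matrix (Fin S) (Fin S) ℝ) (B : L2I →L[ℝ] L2I) :
    partialTrace₁ (tensorOp A B) = A.trace • B := by
  simp [partialTrace₁, block_tensorOp, Matrix.trace, Finset.sum_smul]

/-- `Tr₂ (A ⊗̃ B) = Tr(B) A`. -/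
theorem partialTrace₂_tensorOp (A : Matrix (Fin S) (Fin S) ℝ) (B : L2I →L[ℝ] L2I) :
    partialTrace₂ (tensorOp A B) = opTrace B • A := by
  ext s s'
  simp [partialTrace₂, block_tensorOp, opTrace, inner_smul_left, tsum_mul_left, mul_comm]

/-- The "separable part" `C₁ ⊗̃ C₂` of an operator `C` on `(L²)^S`, with
`C₁ = Tr₂(C) / Tr(C)` and `C₂ = Tr₁(C)`. -/
def sepPart (C : Panel S →L[ℝ] Panel S) : Panel S →L[ℝ] Panel S :=
  tensorOp ((opTrace C)⁻¹ • partialTrace₂ C) (partialTrace₁ C)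

/-- The difference `C₁ ⊗̃ C₂ - C`. -/
def sepDiff (C : Panel S →L[ℝ] Panel S) : Panel S →L[ℝ] Panel S := sepPart C - C

/-! ### Weak dependence -/

section Probability

variable {Ω : Type*} [MeasurableSpace Ω]

/-- `L^p`-`m`-approximability of a sequence `(Z_n)` of random elements of a Hilbert space:
`Z_n = f(u_n, u_{n-1}, …)` almost surely, for iid random elements `u_n` of a measurable space
and a measurable `f`, and `∑_{M ≥ 1} ν_p(Z_n - Z_{n,M}) < ∞`, where `Z_{n,M}` is obtained by
replacing `u_{n-M-1}, u_{n-M-2}, …` by an independent copy. Only the joint law of `u` and of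
the independent copy matters; they are realized on `(Ω × Ω, μ ⊗ μ)` as functions of the first
and of the second coordinate. -/
def LpmApproximable {E : Type*} [NormedAddCommGroup E] (p : ℝ≥0∞) (μ : Measure Ω)
    (Z : ℤ → Ω → E) : Prop :=
  (∀ n, MemLp (Z n) p μ) ∧
  ∃ (U : Type w) (_ : MeasurableSpace U) (u : ℤ → Ω → U) (f : (ℕ → U) → E),
    (∀ i, Measurable (u i)) ∧
    iIndepFun u μ ∧
    (∀ i j, IdentDistrib (u i) (u j) μ μ) ∧
    StronglyMeasurable f ∧
    (∀ n, ∀ᵐ ω ∂μ, Z n ω = f (fun k => u (n - k) ω)) ∧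
    ∀ n, ∑' M : ℕ, eLpNorm (fun q : Ω × Ω => Z n q.1 -
      f (fun k => if k ≤ M + 1 then u (n - k) q.1 else u (n - k) q.2)) p (μ.prod μ) < ∞

/-- The lag `h` covariance operator `C^{(h)} = E[X_0 ⊗ X_h]` of a centered stationary sequence,
where `x ⊗ y` is the operator `z ↦ ⟪y, z⟫ x`. -/
def lagCov (μ : Measure Ω) (X : ℤ → Ω → Panel S) (h : ℕ) : Panel S →L[ℝ] Panel S :=
  ∫ ω, InnerProductSpace.rankOne ℝ (X 0 ω) (X h ω) ∂μ

/-- The estimator `(N - h)⁻¹ ∑_{n=1}^{N-h} X_n ⊗ X_{n+h}` of `C^{(h)}` from `X_1, …, X_N`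
(meaningful for `N > h`). -/
def lagCovHat (X : ℤ → Ω → Panel S) (h N : ℕ) (ω : Ω) : Panel S →L[ℝ] Panel S :=
  ((N : ℝ) - h)⁻¹ •
    ∑ n ∈ Finset.Icc 1 (N - h), InnerProductSpace.rankOne ℝ (X n ω) (X (n + h) ω)

/-- The test statistic `T̂ = N ‖Ĉ₁ ⊗̃ Ĉ₂ - Ĉ‖²`, in the Hilbert-Schmidt norm. -/
def testStat (X : ℤ → Ω → Panel S) (h N : ℕ) (ω : Ω) : ℝ :=
  N * hsNorm (sepDiff (lagCovHat X h N ω)) ^ 2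

/-- `Y_N = O_P(a_N)` as `N → ∞`. -/
def IsBigOP (μ : Measure Ω) (Y : ℕ → Ω → ℝ) (a : ℕ → ℝ) : Prop :=
  ∀ ε : ℝ≥0∞, 0 < ε → ∃ K : ℝ, ∀ᶠ N in atTop, μ {ω | K * a N < |Y N ω|} ≤ ε

/-- `Y_N → ∞` in probability as `N → ∞`. -/
def TendstoInftyInProbability (μ : Measure Ω) (Y : ℕ → Ω → ℝ) : Prop :=
  ∀ K : ℝ, Tendsto (fun N => μ {ω | Y N ω ≤ K}) atTop (𝓝 0)

end Probability

end

end SepTest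

open SepTest

/-!
The traces and partial traces entering the separable part are not continuous in the
Hilbert–Schmidt norm, so the estimator is compared with its target in the stronger distance
`traceDist`, which adds to the Hilbert–Schmidt norm the distances of the trace and of the matrix
of block traces. Every term of this distance has one and the same form: it is the norm of
`(N - h)⁻¹ ∑ B (X_n, X_{n+h}) - E B (X_0, X_h)` for a bounded bilinear map `B` into a Hilbert
space, namely `(x, y) ↦ x ⊗ y` into the Hilbert–Schmidt operators, `(x, y) ↦ ⟪x, y⟫`, and
`(x, y) ↦ ⟪x_s, y_{s'}⟫`.

For an `L⁴`-`m`-approximable sequence such averages have mean square error `O(1/N)`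
(`LpmApproximable.exists_lintegral_average_le`). The point is a summable bound for the covariance
of `B (X_n, X_{n+h})` and `B (X_m, X_{m+h})`: if `m > n + h + 1`, replacing the innovations
`u_j`, `j ≤ n + h`, by an independent copy makes the later product uncorrelated with the earlier
one, and costs an `L²` error that Hölder's inequality bounds by the `L⁴` coupling errors of `X`,
which are summable in `m - n` by `m`-approximability
(`enorm_integral_inner_centeredProduct_le`, `exists_summable_covariance_bound`).

By Chebyshev's inequality `traceDist (Ĉ, C) = O_P(N^{-1/2})`. Since `Tr C ≠ 0`, the squared
Hilbert–Schmidt norm of `C₁ ⊗̃ C₂ - C` is locally Lipschitz at `C` for this distance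
(`exists_abs_hsNorm_sepDiff_sq_sub_le`), which gives `T̂ = N ‖Δ‖² + O_P(N^{1/2})`. As `‖Δ‖ > 0`,
the leading term dominates, and divergence in probability and consistency follow.
-/

namespace SepTest

/-! ### Hilbert–Schmidt operators -/

section HilbertSchmidt

variable {E F G : Type*}
  [NormedAddCommGroup E] [InnerProductSpace ℝ E] [CompleteSpace E]
  [NormedAddCommGroup F] [InnerProductSpace ℝ F] [CompleteSpace F]
  [NormedAddCommGroup G] [InnerProductSpace ℝ G] [CompleteSpace G]

/-- The squared Hilbert–Schmidt norm `∑ i, ‖T e_i‖²` as an extended nonnegative number, for an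
operator between two possibly different Hilbert spaces. -/
noncomputable def hsSum (T : E →L[ℝ] F) : ℝ≥0∞ := ∑' i, ‖T (onb E i)‖ₑ ^ 2

theorem tsum_enorm_inner_onb_sq (x : E) : ∑' i, ‖inner ℝ (onb E i) x‖ₑ ^ 2 = ‖x‖ₑ ^ 2 := by
  have h := (onb E).hasSum_inner_mul_inner x x
  have h2 : HasSum (fun i => ‖inner ℝ (onb E i) x‖ ^ 2) (‖x‖ ^ 2) := by
    rw [← real_inner_self_eq_norm_sq]
    refine h.congr_fun ?_
    intro i
    rw [real_inner_comm x, Real.norm_eq_abs, sq_abs, sq]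
  have h3 := ENNReal.ofReal_tsum_of_nonneg (fun i => sq_nonneg _) h2.summable
  rw [h2.tsum_eq] at h3
  simpa only [ENNReal.ofReal_pow (norm_nonneg _), ofReal_norm] using h3.symm

theorem hsSum_eq_tsum_tsum (T : E →L[ℝ] F) :
    hsSum T = ∑' i, ∑' j, ‖inner ℝ (onb F j) (T (onb E i))‖ₑ ^ 2 := by
  simp only [hsSum, tsum_enorm_inner_onb_sq]

/-- The Hilbert–Schmidt norm of the adjoint; this is what makes the norm independent of the
orthonormal basis. -/
theorem hsSum_adjoint (T : E →L[ℝ] F) : hsSum (ContinuousLinearMap.adjoint T) = hsSum T := by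
  rw [hsSum_eq_tsum_tsum, hsSum_eq_tsum_tsum, ENNReal.tsum_comm]
  simp only [ContinuousLinearMap.adjoint_inner_right]
  simp only [real_inner_comm]

omit [CompleteSpace F] [CompleteSpace G] in
theorem hsSum_comp_left_le (A : F →L[ℝ] G) (T : E →L[ℝ] F) :
    hsSum (A ∘L T) ≤ ‖A‖ₑ ^ 2 * hsSum T := by
  rw [hsSum, hsSum, ← ENNReal.tsum_mul_left]
  refine ENNReal.tsum_le_tsum fun i => ?_
  rw [← mul_pow]
  exact pow_le_pow_left' (A.le_opENorm _) 2

theorem hsSum_comp_right_le (T : F →L[ℝ] G) (U : E →L[ℝ] F) :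
    hsSum (T ∘L U) ≤ ‖U‖ₑ ^ 2 * hsSum T := by
  rw [← hsSum_adjoint, ContinuousLinearMap.adjoint_comp]
  refine (hsSum_comp_left_le _ _).trans_eq ?_
  rw [hsSum_adjoint]
  congr 2
  simp [enorm, nnnorm]

omit [CompleteSpace G] in
theorem hsSum_comp_comp_le {E' : Type*} [NormedAddCommGroup E'] [InnerProductSpace ℝ E']
    [CompleteSpace E'] {A : F →L[ℝ] G} {U : E' →L[ℝ] E} (hA : ‖A‖ ≤ 1) (hU : ‖U‖ ≤ 1)
    (T : E →L[ℝ] F) : hsSum (A ∘L T ∘L U) ≤ hsSum T := by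
  have aux {a : ℝ≥0∞} (ha : a ≤ 1) (b : ℝ≥0∞) : a ^ 2 * b ≤ b :=
    mul_le_of_le_one_left' (pow_le_one' ha 2)
  have hA' : ‖A‖ₑ ≤ 1 := by simpa [← ofReal_norm] using hA
  have hU' : ‖U‖ₑ ≤ 1 := by simpa [← ofReal_norm] using hU
  exact ((hsSum_comp_left_le _ _).trans (aux hA' _)).trans
    ((hsSum_comp_right_le _ _).trans (aux hU' _))

theorem isHilbertSchmidt_iff_hsSum_ne_top {T : E →L[ℝ] E} :
    IsHilbertSchmidt T ↔ hsSum T ≠ ∞ := by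
  have h : hsSum T = ∑' i, ENNReal.ofReal (‖T (onb E i)‖ ^ 2) := by
    simp [hsSum, ENNReal.ofReal_pow]
  rw [h]
  exact ⟨fun h => h.tsum_ofReal_ne_top, fun h => by
    simpa using! ENNReal.summable_toReal h⟩

theorem hsNorm_eq_sqrt_hsSum (T : E →L[ℝ] E) : hsNorm T = √(hsSum T).toReal := by
  rw [hsNorm, hsSum, ENNReal.tsum_toReal_eq (fun i => by finiteness)]
  simp

theorem hsNorm_nonneg (T : E →L[ℝ] E) : 0 ≤ hsNorm T := Real.sqrt_nonneg _

theorem IsHilbertSchmidt.comp_comp {T : E →L[ℝ] E} (hT : IsHilbertSchmidt T)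
    {A : E →L[ℝ] F} {U : F →L[ℝ] E} (hA : ‖A‖ ≤ 1) (hU : ‖U‖ ≤ 1) :
    IsHilbertSchmidt (A ∘L T ∘L U) := by
  rw [isHilbertSchmidt_iff_hsSum_ne_top] at hT ⊢
  exact ne_top_of_le_ne_top hT (hsSum_comp_comp_le hA hU T)

theorem IsHilbertSchmidt.hsNorm_comp_comp_le {T : E →L[ℝ] E} (hT : IsHilbertSchmidt T)
    {A : E →L[ℝ] F} {U : F →L[ℝ] E} (hA : ‖A‖ ≤ 1) (hU : ‖U‖ ≤ 1) :
    hsNorm (A ∘L T ∘L U) ≤ hsNorm T := by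
  rw [isHilbertSchmidt_iff_hsSum_ne_top] at hT
  rw [hsNorm_eq_sqrt_hsSum, hsNorm_eq_sqrt_hsSum]
  exact Real.sqrt_le_sqrt (ENNReal.toReal_mono hT (hsSum_comp_comp_le hA hU T))

variable (E) in
/-- The Hilbert space of Hilbert–Schmidt operators on `E`, an operator `T` being recorded as the
square summable family `(T e_i)_i`. -/
abbrev HSSpace : Type _ := lp (fun _ : onbIndex E => E) 2

theorem isHilbertSchmidt_iff_memℓp {T : E →L[ℝ] E} :
    IsHilbertSchmidt T ↔ Memℓp (fun i => T (onb E i)) 2 := by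
  rw [memℓp_gen_iff (by simp)]
  simp [IsHilbertSchmidt]

/-- A Hilbert–Schmidt operator as an element of `HSSpace E`. -/
noncomputable def IsHilbertSchmidt.toHS {T : E →L[ℝ] E} (hT : IsHilbertSchmidt T) : HSSpace E :=
  ⟨fun i => T (onb E i), isHilbertSchmidt_iff_memℓp.1 hT⟩

theorem IsHilbertSchmidt.toHS_apply {T : E →L[ℝ] E} (hT : IsHilbertSchmidt T)
    (i : onbIndex E) : hT.toHS i = T (onb E i) := rfl

theorem hsNorm_eq_norm_of_apply {T : E →L[ℝ] E} {x : HSSpace E}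
    (h : ∀ i, x i = T (onb E i)) : hsNorm T = ‖x‖ := by
  rw [lp.norm_eq_tsum_rpow (by simp), hsNorm, Real.sqrt_eq_rpow]
  simp [h]

theorem isHilbertSchmidt_of_apply {T : E →L[ℝ] E} {x : HSSpace E}
    (h : ∀ i, x i = T (onb E i)) : IsHilbertSchmidt T := by
  rw [isHilbertSchmidt_iff_memℓp]
  simpa only [← h] using! lp.memℓp x

variable {T U : E →L[ℝ] E}

theorem IsHilbertSchmidt.zero : IsHilbertSchmidt (0 : E →L[ℝ] E) :=
  isHilbertSchmidt_of_apply (x := 0) (by simp)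

theorem IsHilbertSchmidt.add (hT : IsHilbertSchmidt T) (hU : IsHilbertSchmidt U) :
    IsHilbertSchmidt (T + U) :=
  isHilbertSchmidt_of_apply (x := hT.toHS + hU.toHS) (by simp [IsHilbertSchmidt.toHS_apply])

theorem IsHilbertSchmidt.sub (hT : IsHilbertSchmidt T) (hU : IsHilbertSchmidt U) :
    IsHilbertSchmidt (T - U) :=
  isHilbertSchmidt_of_apply (x := hT.toHS - hU.toHS) (by simp [IsHilbertSchmidt.toHS_apply])

theorem IsHilbertSchmidt.smul (c : ℝ) (hT : IsHilbertSchmidt T) : IsHilbertSchmidt (c • T) :=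
  isHilbertSchmidt_of_apply (x := c • hT.toHS) (by simp [IsHilbertSchmidt.toHS_apply])

theorem IsHilbertSchmidt.sum {ι : Type*} {s : Finset ι} {T : ι → E →L[ℝ] E}
    (hT : ∀ i ∈ s, IsHilbertSchmidt (T i)) : IsHilbertSchmidt (∑ i ∈ s, T i) :=
  Finset.sum_induction T IsHilbertSchmidt (fun _ _ => .add) .zero hT

theorem hsNorm_zero : hsNorm (0 : E →L[ℝ] E) = 0 := by
  rw [hsNorm_eq_norm_of_apply (x := 0) (by simp), norm_zero]

theorem IsHilbertSchmidt.hsNorm_add_le (hT : IsHilbertSchmidt T) (hU : IsHilbertSchmidt U) :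
    hsNorm (T + U) ≤ hsNorm T + hsNorm U := by
  rw [hsNorm_eq_norm_of_apply hT.toHS_apply, hsNorm_eq_norm_of_apply hU.toHS_apply,
    hsNorm_eq_norm_of_apply (x := hT.toHS + hU.toHS) (by simp [IsHilbertSchmidt.toHS_apply])]
  exact norm_add_le _ _

theorem hsNorm_smul (c : ℝ) (hT : IsHilbertSchmidt T) : hsNorm (c • T) = |c| * hsNorm T := by
  rw [hsNorm_eq_norm_of_apply hT.toHS_apply,
    hsNorm_eq_norm_of_apply (x := c • hT.toHS) (by simp [IsHilbertSchmidt.toHS_apply]),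
    norm_smul, Real.norm_eq_abs]

theorem IsHilbertSchmidt.hsNorm_sub_le (hT : IsHilbertSchmidt T) (hU : IsHilbertSchmidt U) :
    hsNorm (T - U) ≤ hsNorm T + hsNorm U := by
  rw [hsNorm_eq_norm_of_apply hT.toHS_apply, hsNorm_eq_norm_of_apply hU.toHS_apply,
    hsNorm_eq_norm_of_apply (x := hT.toHS - hU.toHS) (by simp [IsHilbertSchmidt.toHS_apply])]
  exact norm_sub_le _ _

theorem IsHilbertSchmidt.abs_hsNorm_sub_hsNorm_le (hT : IsHilbertSchmidt T)
    (hU : IsHilbertSchmidt U) : |hsNorm T - hsNorm U| ≤ hsNorm (T - U) := by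
  rw [hsNorm_eq_norm_of_apply hT.toHS_apply, hsNorm_eq_norm_of_apply hU.toHS_apply,
    hsNorm_eq_norm_of_apply (x := hT.toHS - hU.toHS) (by simp [IsHilbertSchmidt.toHS_apply])]
  exact abs_norm_sub_norm_le _ _

theorem hsNorm_sum_le {ι : Type*} {s : Finset ι} {T : ι → E →L[ℝ] E}
    (hT : ∀ i ∈ s, IsHilbertSchmidt (T i)) : hsNorm (∑ i ∈ s, T i) ≤ ∑ i ∈ s, hsNorm (T i) := by
  classical
  induction s using Finset.induction_on with
  | empty => simp [hsNorm_zero]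
  | insert a s ha ih =>
    rw [Finset.sum_insert ha, Finset.sum_insert ha]
    have hs : ∀ i ∈ s, IsHilbertSchmidt (T i) := fun i hi => hT i (Finset.mem_insert_of_mem hi)
    have h1 := (hT a (Finset.mem_insert_self a s)).hsNorm_add_le (.sum hs)
    have h2 := ih hs
    linarith

theorem IsHilbertSchmidt.hsNorm_pos (hT : IsHilbertSchmidt T) (h0 : T ≠ 0) : 0 < hsNorm T := by
  rw [hsNorm_eq_norm_of_apply hT.toHS_apply, norm_pos_iff]
  contrapose! h0
  have hi (i) : T (onb E i) = 0 := by rw [← hT.toHS_apply, h0]; rfl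
  have hspan : Dense (Submodule.span ℝ (Set.range (onb E)) : Set E) := by
    rw [Submodule.dense_iff_topologicalClosure_eq_top]
    exact (onb E).dense_span
  refine ContinuousLinearMap.ext_on hspan ?_
  rintro _ ⟨i, rfl⟩
  simpa using hi i

/-! ### Rank one operators -/

theorem isHilbertSchmidt_rankOne (x y : E) :
    IsHilbertSchmidt (InnerProductSpace.rankOne ℝ x y) := by
  have h := ((onb E).summable_inner_mul_inner y y).mul_left (‖x‖ ^ 2)
  refine h.congr fun i => ?_
  simp only [InnerProductSpace.rankOne_apply, norm_smul, mul_pow, Real.norm_eq_abs, sq_abs]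
  rw [real_inner_comm y]
  ring

theorem hsNorm_rankOne (x y : E) :
    hsNorm (InnerProductSpace.rankOne ℝ x y) = ‖x‖ * ‖y‖ := by
  have h : ∀ i, ‖InnerProductSpace.rankOne ℝ x y (onb E i)‖ ^ 2
      = ‖x‖ ^ 2 * (inner ℝ y (onb E i) * inner ℝ (onb E i) y) := fun i => by
    simp only [InnerProductSpace.rankOne_apply, norm_smul, mul_pow, Real.norm_eq_abs, sq_abs]
    rw [real_inner_comm y]
    ring
  rw [hsNorm, tsum_congr h, tsum_mul_left, (onb E).tsum_inner_mul_inner,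
    real_inner_self_eq_norm_sq, ← mul_pow, Real.sqrt_sq (by positivity)]

variable (E) in
/-- The bounded bilinear map `(x, y) ↦ x ⊗ y` into the Hilbert–Schmidt operators. -/
noncomputable def rankOneHS : E →L[ℝ] E →L[ℝ] HSSpace E :=
  LinearMap.mkContinuous₂
    (LinearMap.mk₂ ℝ (fun x y => (isHilbertSchmidt_rankOne x y).toHS)
      (fun x x' y => by ext i; simp [IsHilbertSchmidt.toHS_apply])
      (fun c x y => by ext i; simp [IsHilbertSchmidt.toHS_apply, smul_comm c])
      (fun x y y' => by ext i; simp [IsHilbertSchmidt.toHS_apply])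
      (fun c x y => by ext i; simp [IsHilbertSchmidt.toHS_apply]))
    1 (fun x y => by
      rw [LinearMap.mk₂_apply, ← hsNorm_eq_norm_of_apply (IsHilbertSchmidt.toHS_apply _),
        hsNorm_rankOne, one_mul])

theorem rankOneHS_apply (x y : E) (i : onbIndex E) :
    rankOneHS E x y i = InnerProductSpace.rankOne ℝ x y (onb E i) := rfl

/-! ### Traces of averages of rank one operators -/

theorem summable_abs_inner_mul_inner (x y : E) :
    Summable fun i => |inner ℝ x (onb E i) * inner ℝ (onb E i) y| :=
  ((onb E).summable_inner_mul_inner x y).abs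

theorem tsum_abs_inner_mul_inner_le (x y : E) :
    ∑' i, |inner ℝ x (onb E i) * inner ℝ (onb E i) y| ≤ ‖x‖ * ‖y‖ := by
  have hx := (onb E).hasSum_inner_mul_inner x x
  have hy := (onb E).hasSum_inner_mul_inner y y
  have h := Real.inner_le_Lp_mul_Lq_tsum_of_nonneg (p := 2) (q := 2)
    (f := fun i => |inner ℝ x (onb E i)|) (g := fun i => |inner ℝ (onb E i) y|)
    (by constructor <;> norm_num) (fun _ => abs_nonneg _) (fun _ => abs_nonneg _)
    (by simpa [real_inner_comm, sq] using hx.summable)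
    (by simpa [real_inner_comm, sq] using hy.summable)
  have e1 : ∑' i, |inner ℝ x (onb E i)| ^ (2 : ℝ) = ‖x‖ ^ 2 := by
    rw [← real_inner_self_eq_norm_sq, ← hx.tsum_eq]
    simp [real_inner_comm, sq]
  have e2 : ∑' i, |inner ℝ (onb E i) y| ^ (2 : ℝ) = ‖y‖ ^ 2 := by
    rw [← real_inner_self_eq_norm_sq, ← hy.tsum_eq]
    simp [real_inner_comm, sq]
  rw [e1, e2, ← Real.sqrt_eq_rpow, ← Real.sqrt_eq_rpow, Real.sqrt_sq (norm_nonneg _),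
    Real.sqrt_sq (norm_nonneg _)] at h
  simpa only [abs_mul] using h

variable (E) in
/-- The bounded bilinear map sending `(x, y)` to the absolutely summable family
`(⟪x, e_i⟫ ⟪e_i, y⟫)_i`, whose sum is the trace of `x ⊗ y`. -/
noncomputable def diagL1 : E →L[ℝ] E →L[ℝ] lp (fun _ : onbIndex E => ℝ) 1 :=
  LinearMap.mkContinuous₂
    (LinearMap.mk₂ ℝ (fun x y => ⟨fun i => inner ℝ x (onb E i) * inner ℝ (onb E i) y,
        memℓp_gen (by simpa using! summable_abs_inner_mul_inner x y)⟩)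
      (fun x x' y => by ext i; simp only [inner_add_left, add_mul]; rfl)
      (fun c x y => by ext i; simp [inner_smul_left, mul_assoc])
      (fun x y y' => by ext i; simp only [inner_add_right, mul_add]; rfl)
      (fun c x y => by ext i; simp [inner_smul_right, mul_left_comm]))
    1 (fun x y => by
      rw [LinearMap.mk₂_apply, lp.norm_eq_tsum_rpow (by simp), one_mul]
      simpa using tsum_abs_inner_mul_inner_le x y)

end HilbertSchmidt

section Integrals

variable {E F : Type*} [NormedAddCommGroup E] [InnerProductSpace ℝ E] [CompleteSpace E]
  [NormedAddCommGroup F] [NormedSpace ℝ F]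
  {Ω : Type*} [MeasurableSpace Ω] {μ : Measure Ω} {X Y : Ω → E}

instance holderTriple_four_four_two : ENNReal.HolderTriple 4 4 2 where
  inv_add_inv_eq_inv := by
    rw [← two_mul, ← ENNReal.toReal_eq_toReal_iff' (by simp [ENNReal.mul_eq_top]) (by simp)]
    norm_num [ENNReal.toReal_mul, ENNReal.toReal_inv]

theorem eLpNorm_bilin_le {E' : Type*} [NormedAddCommGroup E'] [NormedSpace ℝ E']
    {X Y : Ω → E'} (B : E' →L[ℝ] E' →L[ℝ] F) (hX : AEStronglyMeasurable X μ)
    (hY : AEStronglyMeasurable Y μ) :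
    eLpNorm (fun ω => B (X ω) (Y ω)) 2 μ ≤ ‖B‖₊ * eLpNorm X 4 μ * eLpNorm Y 4 μ :=
  eLpNorm_le_eLpNorm_mul_eLpNorm_of_nnnorm hX hY (fun x y => B x y) ‖B‖₊
    (.of_forall fun ω => B.le_opNorm₂ (X ω) (Y ω))

theorem memLp_two_bilin {E' : Type*} [NormedAddCommGroup E'] [NormedSpace ℝ E']
    {X Y : Ω → E'} (B : E' →L[ℝ] E' →L[ℝ] F) (hX : MemLp X 4 μ) (hY : MemLp Y 4 μ) :
    MemLp (fun ω => B (X ω) (Y ω)) 2 μ :=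
  MemLp.of_bilin (fun x y => B x y) ‖B‖₊ hX hY (B.aestronglyMeasurable_comp₂ hX.1 hY.1)
    (.of_forall fun ω => B.le_opNorm₂ (X ω) (Y ω))

omit [CompleteSpace E] in
theorem continuous_rankOne :
    Continuous fun p : E × E => InnerProductSpace.rankOne ℝ p.1 p.2 := by
  have h : Continuous fun p : E × E =>
      ContinuousLinearMap.smulRightL ℝ E E (innerSL ℝ p.2) p.1 :=
    ((ContinuousLinearMap.smulRightL ℝ E E).continuous.comp
      ((innerSL ℝ).continuous.comp continuous_snd)).clm_apply continuous_fst
  exact h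

omit [CompleteSpace E] in
theorem aestronglyMeasurable_rankOne (hX : AEStronglyMeasurable X μ)
    (hY : AEStronglyMeasurable Y μ) :
    AEStronglyMeasurable (fun ω => InnerProductSpace.rankOne ℝ (X ω) (Y ω)) μ := by
  have h := Continuous.comp_aestronglyMeasurable (continuous_rankOne (E := E)) (hX.prodMk hY)
  exact h

omit [InnerProductSpace ℝ E] [CompleteSpace E] in
theorem integrable_norm_mul_norm [IsFiniteMeasure μ] (hX : MemLp X 4 μ) (hY : MemLp Y 4 μ) :
    Integrable (fun ω => ‖X ω‖ * ‖Y ω‖) μ := by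
  have h24 : (2 : ℝ≥0∞) ≤ 4 := by norm_num
  exact (hX.mono_exponent h24).norm.integrable_mul (hY.mono_exponent h24).norm

omit [CompleteSpace E] in
theorem integrable_rankOne [IsFiniteMeasure μ] (hX : MemLp X 4 μ) (hY : MemLp Y 4 μ) :
    Integrable (fun ω => InnerProductSpace.rankOne ℝ (X ω) (Y ω)) μ := by
  refine Integrable.mono' (integrable_norm_mul_norm hX hY)
    (aestronglyMeasurable_rankOne hX.1 hY.1) (.of_forall fun ω => ?_)
  exact (InnerProductSpace.norm_rankOne (X ω) (Y ω)).le

/-- The integral of `X ⊗ Y` in the Hilbert space of Hilbert–Schmidt operators represents the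
operator `E[X ⊗ Y]`, which is therefore Hilbert–Schmidt. -/
theorem integral_rankOneHS_apply [IsFiniteMeasure μ] (hX : MemLp X 4 μ) (hY : MemLp Y 4 μ)
    (i : onbIndex E) :
    (∫ ω, rankOneHS E (X ω) (Y ω) ∂μ) i
      = (∫ ω, InnerProductSpace.rankOne ℝ (X ω) (Y ω) ∂μ) (onb E i) := by
  have h := (lp.evalCLM ℝ (fun _ : onbIndex E => E) 2 i).integral_comp_comm
    ((memLp_two_bilin (rankOneHS E) hX hY).integrable one_le_two)
  rw [ContinuousLinearMap.integral_apply (integrable_rankOne hX hY)]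
  exact h.symm

/-- The trace formula `Tr E[X ⊗ Y] = E⟪X, Y⟫`. The sum over the basis and the expectation are
interchanged by integrating the diagonal of `X ⊗ Y` in `ℓ¹`, which needs no countability of the
basis. -/
theorem opTrace_integral_rankOne [IsFiniteMeasure μ] (hX : MemLp X 4 μ) (hY : MemLp Y 4 μ) :
    opTrace (∫ ω, InnerProductSpace.rankOne ℝ (X ω) (Y ω) ∂μ) = ∫ ω, inner ℝ (X ω) (Y ω) ∂μ := by
  have hint := (memLp_two_bilin (diagL1 E) hX hY).integrable one_le_two
  have h (i) : inner ℝ ((∫ ω, InnerProductSpace.rankOne ℝ (X ω) (Y ω) ∂μ) (onb E i)) (onb E i)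
      = (∫ ω, diagL1 E (X ω) (Y ω) ∂μ) i := by
    have h1 := (lp.evalCLM ℝ (fun _ : onbIndex E => ℝ) 1 i).integral_comp_comm hint
    have hr := integrable_rankOne hX hY
    rw [ContinuousLinearMap.integral_apply hr, real_inner_comm,
      ← integral_inner (hr.apply_continuousLinearMap _)]
    refine Eq.trans (integral_congr_ae (.of_forall fun ω => ?_)) h1
    change _ = inner ℝ (X ω) (onb E i) * inner ℝ (onb E i) (Y ω)
    simp only [InnerProductSpace.rankOne_apply]
    rw [real_inner_smul_right, mul_comm, real_inner_comm (X ω), real_inner_comm (Y ω)]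
  have h2 := (lp.tsumCLM ℝ (onbIndex E) ℝ).integral_comp_comm hint
  rw [opTrace, tsum_congr h]
  refine Eq.trans h2.symm (integral_congr_ae (.of_forall fun ω => ?_))
  exact (onb E).tsum_inner_mul_inner (X ω) (Y ω)

end Integrals

/-! ### Second moments of sums of weakly correlated random elements -/

section SecondMoment

variable {H : Type*} [NormedAddCommGroup H] [InnerProductSpace ℝ H]
  {Ω : Type*} [MeasurableSpace Ω] {μ : Measure Ω}

theorem enorm_integral_inner_le {Y Z : Ω → H} (hY : AEStronglyMeasurable Y μ)
    (hZ : AEStronglyMeasurable Z μ) :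
    ‖∫ ω, inner ℝ (Y ω) (Z ω) ∂μ‖ₑ ≤ eLpNorm Y 2 μ * eLpNorm Z 2 μ := by
  refine (enorm_integral_le_lintegral_enorm _).trans ?_
  rw [← eLpNorm_one_eq_lintegral_enorm]
  have h := eLpNorm_le_eLpNorm_mul_eLpNorm_of_nnnorm (p := 2) (q := 2) (r := 1) hY hZ
    (fun x y => inner ℝ x y) 1 (.of_forall fun ω => by
      rw [one_mul]; exact nnnorm_inner_le_nnnorm (𝕜 := ℝ) (Y ω) (Z ω))
  simpa using h

theorem integrable_inner_of_memLp_two {Y Z : Ω → H} (hY : MemLp Y 2 μ) (hZ : MemLp Z 2 μ) :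
    Integrable (fun ω => inner ℝ (Y ω) (Z ω)) μ :=
  memLp_one_iff_integrable.1 <| MemLp.of_bilin (p := 2) (q := 2) (fun x y => inner ℝ x y) 1 hY hZ
    (hY.1.inner hZ.1) (.of_forall fun ω => by
      rw [one_mul]; exact nnnorm_inner_le_nnnorm (𝕜 := ℝ) (Y ω) (Z ω))

theorem sum_natAbs_sub_le_tsum (c : ℕ → ℝ≥0∞) (s : Finset ℕ) (n : ℕ) :
    ∑ m ∈ s, c ((n : ℤ) - m).natAbs ≤ 2 * ∑' k, c k := by
  classical
  have aux (t : Finset ℕ) (ht : Set.InjOn (fun m : ℕ => ((n : ℤ) - m).natAbs) t) :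
      ∑ m ∈ t, c ((n : ℤ) - m).natAbs ≤ ∑' k, c k := by
    rw [← Finset.sum_image (f := c) ht]
    exact ENNReal.sum_le_tsum _
  rw [← Finset.sum_filter_add_sum_filter_not s (fun m => m ≤ n), two_mul]
  refine add_le_add (aux _ ?_) (aux _ ?_) <;>
  · intro a ha b hb hab
    simp only [Finset.coe_filter, Set.mem_ofPred_eq] at ha hb hab
    omega

/-- If the covariances `E⟪Z_n, Z_m⟫` are dominated by a summable function of `|n - m|`, then the
second moment of a sum of `L` terms grows at most linearly in `L`. -/
theorem lintegral_enorm_sum_sq_le {Z : ℕ → Ω → H} (hZ : ∀ n, MemLp (Z n) 2 μ) (c : ℕ → ℝ≥0∞)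
    (hc : ∀ n m, ‖∫ ω, inner ℝ (Z n ω) (Z m ω) ∂μ‖ₑ ≤ c ((n : ℤ) - m).natAbs)
    (s : Finset ℕ) :
    ∫⁻ ω, ‖∑ n ∈ s, Z n ω‖ₑ ^ 2 ∂μ ≤ s.card * (2 * ∑' k, c k) := by
  have hS : MemLp (fun ω => ∑ n ∈ s, Z n ω) 2 μ := memLp_finsetSum s fun n _ => hZ n
  have h1 : ∫⁻ ω, ‖∑ n ∈ s, Z n ω‖ₑ ^ 2 ∂μ = ‖∫ ω, ‖∑ n ∈ s, Z n ω‖ ^ 2 ∂μ‖ₑ := by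
    rw [Real.enorm_of_nonneg (by positivity),
      ofReal_integral_eq_lintegral_ofReal hS.norm.integrable_sq (.of_forall fun ω => sq_nonneg _)]
    simp only [ENNReal.ofReal_pow (norm_nonneg _), ofReal_norm]
  have hint (n m) : Integrable (fun ω => inner ℝ (Z n ω) (Z m ω)) μ :=
    integrable_inner_of_memLp_two (hZ n) (hZ m)
  have h2 : ∫ ω, ‖∑ n ∈ s, Z n ω‖ ^ 2 ∂μ
      = ∑ n ∈ s, ∑ m ∈ s, ∫ ω, inner ℝ (Z n ω) (Z m ω) ∂μ := by
    simp_rw [← real_inner_self_eq_norm_sq, sum_inner, inner_sum]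
    rw [integral_finsetSum _ fun n _ => integrable_finsetSum _ fun m _ => hint n m]
    exact Finset.sum_congr rfl fun n _ => integral_finsetSum _ fun m _ => hint n m
  rw [h1, h2]
  calc ‖∑ n ∈ s, ∑ m ∈ s, ∫ ω, inner ℝ (Z n ω) (Z m ω) ∂μ‖ₑ
      ≤ ∑ n ∈ s, ∑ m ∈ s, c ((n : ℤ) - m).natAbs :=
        (enorm_sum_le _ _).trans (Finset.sum_le_sum fun n _ =>
          (enorm_sum_le _ _).trans (Finset.sum_le_sum fun m _ => hc n m))
    _ ≤ ∑ n ∈ s, 2 * ∑' k, c k := Finset.sum_le_sum fun n _ => sum_natAbs_sub_le_tsum c s n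
    _ = s.card * (2 * ∑' k, c k) := by rw [Finset.sum_const, nsmul_eq_mul]

end SecondMoment

/-! ### Independence of past and future -/

section Independence

variable {H : Type*} [NormedAddCommGroup H] [InnerProductSpace ℝ H] [CompleteSpace H]
  {Ω : Type*} [MeasurableSpace Ω] {μ : Measure Ω}

/-- A centered function of `V` is uncorrelated with every function of `W`, if `V` and `W` are
independent. No integrability of `g` is needed: if `⟪a, g⟫` is not integrable, its Bochner
integral is zero by convention. -/
theorem integral_inner_eq_zero_of_indepFun [IsFiniteMeasure μ] {α β : Type*} [MeasurableSpace α]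
    [MeasurableSpace β] {V : Ω → α} {W : Ω → β} (hV : Measurable V) (hW : Measurable W)
    (hVW : IndepFun V W μ) {a : α → H} {g : β → H} (ha : StronglyMeasurable a)
    (hg : StronglyMeasurable g) (hint : Integrable (fun ω => a (V ω)) μ)
    (h0 : ∫ ω, a (V ω) ∂μ = 0) : ∫ ω, inner ℝ (a (V ω)) (g (W ω)) ∂μ = 0 := by
  have hm : StronglyMeasurable fun z : α × β => inner ℝ (a z.1) (g z.2) :=
    (ha.comp_measurable measurable_fst).inner (hg.comp_measurable measurable_snd)
  have h1 := integral_map (hV.prodMk hW).aemeasurable (μ := μ) hm.aestronglyMeasurable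
  rw [(indepFun_iff_map_prod_eq_prod_map_map hV.aemeasurable hW.aemeasurable).1 hVW] at h1
  rw [← h1]
  by_cases hi : Integrable (fun z : α × β => inner ℝ (a z.1) (g z.2))
      ((μ.map V).prod (μ.map W))
  · have hai : Integrable a (μ.map V) := by
      rw [integrable_map_measure ha.aestronglyMeasurable hV.aemeasurable]
      exact hint
    rw [integral_prod_symm _ hi]
    refine integral_eq_zero_of_ae (.of_forall fun y => ?_)
    simp only [Pi.zero_apply]
    simp_rw [real_inner_comm (g y)]
    rw [integral_inner hai, integral_map hV.aemeasurable ha.aestronglyMeasurable, h0,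
      inner_zero_right]
  · exact integral_undef hi

theorem iIndepFun.indepFun_of_le_of_lt {U : Type*} [MeasurableSpace U] {u : ℤ → Ω → U}
    (hu : ∀ i, Measurable (u i)) (hind : iIndepFun u μ) (n : ℤ) :
    IndepFun (fun ω (j : {j : ℤ // j ≤ n}) => u j ω) (fun ω (j : {j : ℤ // n < j}) => u j ω) μ := by
  have h := indep_iSup_of_disjoint (fun i => (hu i).comap_le) hind
    (S := {j | j ≤ n}) (T := {j | n < j})
    (Set.disjoint_left.2 fun j (h1 : j ≤ n) h2 => not_lt.2 h1 h2)
  rw [IndepFun_iff_Indep]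
  refine indep_of_indep_of_le_left (indep_of_indep_of_le_right h ?_) ?_
  · refine Measurable.comap_le (@measurable_pi_lambda _ _ _ (_) _ _ fun j => ?_)
    exact (comap_measurable (u j)).mono (le_iSup₂_of_le j.1 j.2 le_rfl) le_rfl
  · refine Measurable.comap_le (@measurable_pi_lambda _ _ _ (_) _ _ fun j => ?_)
    exact (comap_measurable (u j)).mono (le_iSup₂_of_le j.1 j.2 le_rfl) le_rfl

end Independence

/-! ### Products of Bernoulli shifts -/

section BernoulliShift

variable {Ω : Type*} [MeasurableSpace Ω] {μ : Measure Ω}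
  {U : Type*} [MeasurableSpace U] {E : Type*} [NormedAddCommGroup E]

/-- The Bernoulli shift `f (u_n, u_{n-1}, …)`. -/
def bernoulliShift (f : (ℕ → U) → E) (u : ℤ → Ω → U) (n : ℤ) (ω : Ω) : E :=
  f fun k => u (n - k) ω

/-- The coupled variable `f (u_n, …, u_{n-M-1}, u*_{n-M-2}, …)`, the independent copy `u*` being
read off the second coordinate. -/
def coupledShift (f : (ℕ → U) → E) (u : ℤ → Ω → U) (n : ℤ) (M : ℕ) (q : Ω × Ω) : E :=
  f fun k => if k ≤ M + 1 then u (n - k) q.1 else u (n - k) q.2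

variable {u : ℤ → Ω → U} {f : (ℕ → U) → E}

theorem measurable_past (hu : ∀ i, Measurable (u i)) (n : ℤ) :
    Measurable fun ω (k : ℕ) => u (n - k) ω :=
  measurable_pi_lambda _ fun _ => hu _

theorem map_past_eq (hu : ∀ i, Measurable (u i)) (hind : iIndepFun u μ)
    (hid : ∀ i j, IdentDistrib (u i) (u j) μ μ) (n m : ℤ) :
    μ.map (fun ω (k : ℕ) => u (n - k) ω) = μ.map (fun ω (k : ℕ) => u (m - k) ω) := by
  have aux (n : ℤ) : μ.map (fun ω (k : ℕ) => u (n - k) ω)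
      = Measure.infinitePi fun _ : ℕ => μ.map (u 0) := by
    have hinj : Function.Injective fun k : ℕ => n - (k : ℤ) := fun a b hab => by
      simpa using hab
    have h := iIndepFun.map_fun_eq_infinitePi_map (fun k : ℕ => hu (n - k)) (hind.precomp hinj)
    rw [h]
    congr 1
    funext k
    exact (hid _ _).map_eq
  rw [aux, aux]

theorem stronglyMeasurable_bernoulliShift (hu : ∀ i, Measurable (u i)) (hf : StronglyMeasurable f)
    (n : ℤ) : StronglyMeasurable (bernoulliShift f u n) :=
  hf.comp_measurable (measurable_past hu n)

theorem stronglyMeasurable_coupledShift (hu : ∀ i, Measurable (u i)) (hf : StronglyMeasurable f)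
    (n : ℤ) (M : ℕ) : StronglyMeasurable (coupledShift f u n M) := by
  refine hf.comp_measurable (measurable_pi_lambda _ fun k => ?_)
  split_ifs
  · exact (hu _).comp measurable_fst
  · exact (hu _).comp measurable_snd

theorem eLpNorm_bernoulliShift_eq (hu : ∀ i, Measurable (u i)) (hind : iIndepFun u μ)
    (hid : ∀ i j, IdentDistrib (u i) (u j) μ μ) (hf : StronglyMeasurable f) (p : ℝ≥0∞) (n m : ℤ) :
    eLpNorm (bernoulliShift f u n) p μ = eLpNorm (bernoulliShift f u m) p μ := by
  have h (n : ℤ) := eLpNorm_map_measure (p := p) (hf.aestronglyMeasurable)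
    (measurable_past hu n).aemeasurable (μ := μ)
  have h2 := h n
  rw [map_past_eq hu hind hid n m, h m] at h2
  exact h2.symm

/-- The coupling error does not depend on the time index. -/
theorem eLpNorm_sub_coupledShift_eq [SFinite μ] (hu : ∀ i, Measurable (u i)) (hind : iIndepFun u μ)
    (hid : ∀ i j, IdentDistrib (u i) (u j) μ μ) (hf : StronglyMeasurable f) (p : ℝ≥0∞)
    (M : ℕ) (n m : ℤ) :
    eLpNorm (fun q : Ω × Ω => bernoulliShift f u n q.1 - coupledShift f u n M q) p (μ.prod μ)
      = eLpNorm (fun q : Ω × Ω => bernoulliShift f u m q.1 - coupledShift f u m M q) p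
        (μ.prod μ) := by
  let Φ : (ℕ → U) × (ℕ → U) → E := fun z => f z.1 - f fun k => if k ≤ M + 1 then z.1 k else z.2 k
  have hΦ : StronglyMeasurable Φ := by
    refine (hf.comp_measurable measurable_fst).sub
      (hf.comp_measurable (measurable_pi_lambda _ fun k => ?_))
    split_ifs
    · exact (measurable_pi_apply k).comp measurable_fst
    · exact (measurable_pi_apply k).comp measurable_snd
  have h (n : ℤ) := eLpNorm_map_measure (p := p) (hΦ.aestronglyMeasurable)
    ((measurable_past hu n).prodMap (measurable_past hu n)).aemeasurable (μ := μ.prod μ)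
  simp_rw [← Measure.map_prod_map _ _ (measurable_past hu _) (measurable_past hu _)] at h
  have h2 := h n
  rw [map_past_eq hu hind hid n m, h m] at h2
  exact h2.symm

variable [NormedSpace ℝ E] {H : Type*} [NormedAddCommGroup H] [InnerProductSpace ℝ H]

/-- The mean of the product `B (X_n, X_{n+h})` does not depend on `n`. -/
theorem integral_bilin_bernoulliShift_eq (hu : ∀ i, Measurable (u i)) (hind : iIndepFun u μ)
    (hid : ∀ i j, IdentDistrib (u i) (u j) μ μ) (hf : StronglyMeasurable f)
    (B : E →L[ℝ] E →L[ℝ] H) (h : ℕ) (n m : ℤ) :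
    ∫ ω, B (bernoulliShift f u n ω) (bernoulliShift f u (n + h) ω) ∂μ
      = ∫ ω, B (bernoulliShift f u m ω) (bernoulliShift f u (m + h) ω) ∂μ := by
  let Φ : (ℕ → U) → H := fun w => B (f fun k => w (k + h)) (f w)
  have hΦ : StronglyMeasurable Φ := by
    have h1 : StronglyMeasurable fun w : ℕ → U => f fun k => w (k + h) :=
      hf.comp_measurable (measurable_pi_lambda _ fun k => measurable_pi_apply (k + h))
    exact B.continuous₂.comp_stronglyMeasurable (h1.prodMk hf)
  have key (n : ℤ) := integral_map (measurable_past hu (n + h)).aemeasurable (μ := μ)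
    hΦ.aestronglyMeasurable
  have e (n : ℤ) : ∀ ω, Φ (fun k => u (n + h - k) ω)
      = B (bernoulliShift f u n ω) (bernoulliShift f u (n + h) ω) := fun ω => by
    have : (fun k : ℕ => u (n + h - ((k + h : ℕ) : ℤ)) ω) = fun k : ℕ => u (n - k) ω := by
      funext k
      congr 1
      push_cast
      ring
    simp only [Φ, bernoulliShift, this]
  simp only [e] at key
  rw [← key n, ← key m, map_past_eq hu hind hid (n + h) (m + h)]

variable [IsProbabilityMeasure μ]

/-- A centered variable that depends on `u_j`, `j ≤ n + h`, is uncorrelated with a product of two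
coupled variables that only use `u_j` for `j > n + h` and the independent copy. -/
theorem integral_inner_coupledShift_eq_zero [CompleteSpace H]
    (hu : ∀ i, Measurable (u i)) (hind : iIndepFun u μ)
    (hf : StronglyMeasurable f) (B : E →L[ℝ] E →L[ℝ] H) (h : ℕ) (n : ℤ) (M : ℕ) (e : H)
    (hint : MemLp (fun ω => B (bernoulliShift f u n ω) (bernoulliShift f u (n + h) ω) - e) 2 μ)
    (h0 : ∫ ω, (B (bernoulliShift f u n ω) (bernoulliShift f u (n + h) ω) - e) ∂μ = 0)
    (hint' : MemLp (fun q : Ω × Ω => B (coupledShift f u (n + h + 2 + M) M q)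
      (coupledShift f u (n + h + 2 + M + h) (M + h) q) - e) 2 (μ.prod μ)) :
    ∫ q : Ω × Ω, inner ℝ (B (bernoulliShift f u n q.1) (bernoulliShift f u (n + h) q.1) - e)
      (B (coupledShift f u (n + h + 2 + M) M q)
        (coupledShift f u (n + h + 2 + M + h) (M + h) q) - e) ∂(μ.prod μ) = 0 := by
  rw [integral_prod_symm _ (integrable_inner_of_memLp_two (hint.comp_fst μ) hint')]
  refine integral_eq_zero_of_ae (.of_forall fun ω' => ?_)
  simp only [Pi.zero_apply]
  let V : Ω → ({j : ℤ // j ≤ n + h} → U) := fun ω j => u j ω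
  let W : Ω → ({j : ℤ // n + h < j} → U) := fun ω j => u j ω
  have hV : Measurable V := measurable_pi_lambda _ fun j => hu j
  have hW : Measurable W := measurable_pi_lambda _ fun j => hu j
  let past (i : ℕ) (x : {j : ℤ // j ≤ n + h} → U) : E :=
    f fun k => x ⟨n + h - (k + i : ℕ), by omega⟩
  have hpast (i : ℕ) : StronglyMeasurable (past i) :=
    hf.comp_measurable (measurable_pi_lambda _ fun k => measurable_pi_apply _)
  let fut (m : ℤ) (y : {j : ℤ // n + h < j} → U) : E :=
    f fun k => if hk : n + h < m - k then y ⟨m - k, hk⟩ else u (m - k) ω'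
  have hfut (m : ℤ) : StronglyMeasurable (fut m) := by
    refine hf.comp_measurable (measurable_pi_lambda _ fun k => ?_)
    split_ifs
    · exact measurable_pi_apply _
    · exact measurable_const
  have hbil {α : Type _} [MeasurableSpace α] {x y : α → E} (hx : StronglyMeasurable x)
      (hy : StronglyMeasurable y) : StronglyMeasurable fun z => B (x z) (y z) - e :=
    (B.continuous₂.comp_stronglyMeasurable (hx.prodMk hy)).sub stronglyMeasurable_const
  have e1 (ω : Ω) : past h (V ω) = bernoulliShift f u n ω := by
    simp only [past, V, bernoulliShift]
    congr 1; funext k; congr 1; push_cast; ring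
  have e2 (ω : Ω) : past 0 (V ω) = bernoulliShift f u (n + h) ω := rfl
  have e3 (ω : Ω) (i : ℕ) : fut (n + h + 2 + M + i) (W ω)
      = coupledShift f u (n + h + 2 + M + i) (M + i) (ω, ω') := by
    simp only [fut, W, coupledShift]
    congr 1; funext k
    by_cases hk : k ≤ M + i + 1
    · rw [if_pos hk, dif_pos (by omega)]
    · rw [if_neg hk, dif_neg (by omega)]
  have e4 (ω : Ω) : fut (n + h + 2 + M) (W ω) = coupledShift f u (n + h + 2 + M) M (ω, ω') := by
    simpa using e3 ω 0
  have key := integral_inner_eq_zero_of_indepFun hV hW (iIndepFun.indepFun_of_le_of_lt hu hind _)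
    (hbil (hpast h) (hpast 0)) (hbil (hfut (n + h + 2 + M)) (hfut (n + h + 2 + M + h)))
  simp only [e1, e2, e3, e4] at key
  exact key (hint.integrable one_le_two) h0

/-- The coupling error of a product of two Bernoulli shifts. -/
theorem eLpNorm_bilin_sub_coupledShift_le (hu : ∀ i, Measurable (u i)) (hind : iIndepFun u μ)
    (hid : ∀ i j, IdentDistrib (u i) (u j) μ μ) (hf : StronglyMeasurable f)
    (B : E →L[ℝ] E →L[ℝ] H) (h : ℕ) (m : ℤ) (M : ℕ) (d : ℕ → ℝ≥0∞)
    (hd : ∀ M, d M = eLpNorm (fun q : Ω × Ω => bernoulliShift f u 0 q.1 - coupledShift f u 0 M q) 4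
      (μ.prod μ)) :
    eLpNorm (fun q : Ω × Ω => B (bernoulliShift f u m q.1) (bernoulliShift f u (m + h) q.1)
        - B (coupledShift f u m M q) (coupledShift f u (m + h) (M + h) q)) 2 (μ.prod μ)
      ≤ ‖B‖₊ * (eLpNorm (bernoulliShift f u 0) 4 μ * d M
          + (eLpNorm (bernoulliShift f u 0) 4 μ + d M) * d (M + h)) := by
  have hs (m : ℤ) : AEStronglyMeasurable (fun q : Ω × Ω => bernoulliShift f u m q.1) (μ.prod μ) :=
    ((stronglyMeasurable_bernoulliShift hu hf m).comp_measurable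
      measurable_fst).aestronglyMeasurable
  have hc (m : ℤ) (M : ℕ) : AEStronglyMeasurable (coupledShift f u m M) (μ.prod μ) :=
    (stronglyMeasurable_coupledShift hu hf m M).aestronglyMeasurable
  have hd' (m : ℤ) (M : ℕ) : eLpNorm (fun q : Ω × Ω => bernoulliShift f u m q.1
      - coupledShift f u m M q) 4 (μ.prod μ) = d M := by
    rw [hd, eLpNorm_sub_coupledShift_eq hu hind hid hf 4 M m 0]
  have hV (m : ℤ) : eLpNorm (fun q : Ω × Ω => bernoulliShift f u m q.1) 4 (μ.prod μ)
      = eLpNorm (bernoulliShift f u 0) 4 μ := by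
    rw [← eLpNorm_bernoulliShift_eq hu hind hid hf 4 m 0]
    exact eLpNorm_comp_measurePreserving
      (stronglyMeasurable_bernoulliShift hu hf m).aestronglyMeasurable measurePreserving_fst
  have hC : eLpNorm (coupledShift f u m M) 4 (μ.prod μ)
      ≤ eLpNorm (bernoulliShift f u 0) 4 μ + d M := by
    have h1 : coupledShift f u m M = (fun q : Ω × Ω => bernoulliShift f u m q.1)
        - fun q : Ω × Ω => bernoulliShift f u m q.1 - coupledShift f u m M q := by
      funext q; simp
    rw [h1, ← hV m, ← hd' m M]
    exact eLpNorm_sub_le (hs m) ((hs m).sub (hc m M)) (by norm_num)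
  have hsplit : (fun q : Ω × Ω => B (bernoulliShift f u m q.1) (bernoulliShift f u (m + h) q.1)
        - B (coupledShift f u m M q) (coupledShift f u (m + h) (M + h) q))
      = (fun q : Ω × Ω => B (bernoulliShift f u m q.1 - coupledShift f u m M q)
          (bernoulliShift f u (m + h) q.1))
        + fun q : Ω × Ω => B (coupledShift f u m M q)
          (bernoulliShift f u (m + h) q.1 - coupledShift f u (m + h) (M + h) q) := by
    funext q; simp
  rw [hsplit]
  refine (eLpNorm_add_le (B.aestronglyMeasurable_comp₂ ((hs m).sub (hc m M)) (hs _))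
    (B.aestronglyMeasurable_comp₂ (hc m M) ((hs _).sub (hc _ _))) one_le_two).trans ?_
  refine (add_le_add (eLpNorm_bilin_le B ((hs m).sub (hc m M)) (hs _))
    (eLpNorm_bilin_le B (hc m M) ((hs _).sub (hc _ _)))).trans ?_
  simp only [Pi.sub_def]
  rw [hd', hd', hV, mul_add, mul_assoc, mul_assoc, mul_comm (d M) (eLpNorm _ _ _)]
  gcongr

end BernoulliShift

/-! ### Mean square rate for averages of lagged products -/

section Averages

variable {Ω : Type*} [MeasurableSpace Ω] {μ : Measure Ω}
  {U : Type*} [MeasurableSpace U] {E : Type*} [NormedAddCommGroup E]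
  {u : ℤ → Ω → U} {f : (ℕ → U) → E}

theorem eLpNorm_comp_fst [IsProbabilityMeasure μ] {g : Ω → E} {p : ℝ≥0∞}
    (hg : AEStronglyMeasurable g μ) :
    eLpNorm (fun q : Ω × Ω => g q.1) p (μ.prod μ) = eLpNorm g p μ :=
  eLpNorm_comp_measurePreserving hg measurePreserving_fst

theorem memLp_bernoulliShift (hu : ∀ i, Measurable (u i)) (hind : iIndepFun u μ)
    (hid : ∀ i j, IdentDistrib (u i) (u j) μ μ) (hf : StronglyMeasurable f) {p : ℝ≥0∞}
    (hX : MemLp (bernoulliShift f u 0) p μ) (n : ℤ) : MemLp (bernoulliShift f u n) p μ :=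
  ⟨(stronglyMeasurable_bernoulliShift hu hf n).aestronglyMeasurable, by
    rw [eLpNorm_bernoulliShift_eq hu hind hid hf p n 0]; exact hX.2⟩

variable [NormedSpace ℝ E] {H : Type*} [NormedAddCommGroup H] [InnerProductSpace ℝ H]

/-- The centered product `B (X_n, X_{n+h}) - E B (X_0, X_h)` of two Bernoulli shifts. -/
noncomputable def centeredProduct (μ : Measure Ω) (f : (ℕ → U) → E) (u : ℤ → Ω → U)
    (B : E →L[ℝ] E →L[ℝ] H) (h : ℕ) (n : ℤ) (ω : Ω) : H :=
  B (bernoulliShift f u n ω) (bernoulliShift f u (n + h) ω)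
    - ∫ ω, B (bernoulliShift f u 0 ω) (bernoulliShift f u h ω) ∂μ

variable [IsProbabilityMeasure μ]

theorem memLp_centeredProduct (hu : ∀ i, Measurable (u i)) (hind : iIndepFun u μ)
    (hid : ∀ i j, IdentDistrib (u i) (u j) μ μ) (hf : StronglyMeasurable f)
    (hX : MemLp (bernoulliShift f u 0) 4 μ) (B : E →L[ℝ] E →L[ℝ] H) (h : ℕ) (n : ℤ) :
    MemLp (centeredProduct μ f u B h n) 2 μ :=
  (memLp_two_bilin B (memLp_bernoulliShift hu hind hid hf hX n)
    (memLp_bernoulliShift hu hind hid hf hX _)).sub (memLp_const _)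

theorem eLpNorm_centeredProduct_le (hu : ∀ i, Measurable (u i)) (hind : iIndepFun u μ)
    (hid : ∀ i j, IdentDistrib (u i) (u j) μ μ) (hf : StronglyMeasurable f)
    (B : E →L[ℝ] E →L[ℝ] H) (h : ℕ) (n : ℤ) :
    eLpNorm (centeredProduct μ f u B h n) 2 μ
      ≤ ‖B‖₊ * eLpNorm (bernoulliShift f u 0) 4 μ * eLpNorm (bernoulliShift f u 0) 4 μ
        + ‖∫ ω, B (bernoulliShift f u 0 ω) (bernoulliShift f u h ω) ∂μ‖ₑ := by
  have hs (n : ℤ) : AEStronglyMeasurable (bernoulliShift f u n) μ :=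
    (stronglyMeasurable_bernoulliShift hu hf n).aestronglyMeasurable
  refine (eLpNorm_sub_le (B.aestronglyMeasurable_comp₂ (hs n) (hs (n + h)))
    aestronglyMeasurable_const one_le_two).trans ?_
  refine add_le_add ((eLpNorm_bilin_le B (hs _) (hs _)).trans_eq ?_) ?_
  · rw [eLpNorm_bernoulliShift_eq hu hind hid hf 4 n 0,
      eLpNorm_bernoulliShift_eq hu hind hid hf 4 (n + h) 0]
  · rw [eLpNorm_const _ (by norm_num) (NeZero.ne μ)]
    simp

theorem integral_centeredProduct [CompleteSpace H] (hu : ∀ i, Measurable (u i))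
    (hind : iIndepFun u μ) (hid : ∀ i j, IdentDistrib (u i) (u j) μ μ)
    (hf : StronglyMeasurable f) (hX : MemLp (bernoulliShift f u 0) 4 μ)
    (B : E →L[ℝ] E →L[ℝ] H) (h : ℕ) (n : ℤ) : ∫ ω, centeredProduct μ f u B h n ω ∂μ = 0 := by
  have hY := (memLp_two_bilin B (memLp_bernoulliShift hu hind hid hf hX n)
    (memLp_bernoulliShift hu hind hid hf hX (n + h))).integrable one_le_two
  simp only [centeredProduct]
  rw [integral_sub hY (integrable_const _), integral_const, probReal_univ, one_smul,
    integral_bilin_bernoulliShift_eq hu hind hid hf B h n 0]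
  simp

/-- At lags above `h + 1` the later product can be replaced by its coupled version, which is
uncorrelated with the earlier product; hence the covariance is bounded by the coupling error. -/
theorem enorm_integral_inner_centeredProduct_le [CompleteSpace H] (hu : ∀ i, Measurable (u i))
    (hind : iIndepFun u μ) (hid : ∀ i j, IdentDistrib (u i) (u j) μ μ)
    (hf : StronglyMeasurable f) (hX : MemLp (bernoulliShift f u 0) 4 μ)
    (B : E →L[ℝ] E →L[ℝ] H) (h : ℕ) (d : ℕ → ℝ≥0∞)
    (hd : ∀ M, d M = eLpNorm (fun q : Ω × Ω => bernoulliShift f u 0 q.1 - coupledShift f u 0 M q) 4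
      (μ.prod μ)) (hd_top : ∀ M, d M ≠ ∞) (n : ℤ) (M : ℕ) :
    ‖∫ ω, inner ℝ (centeredProduct μ f u B h n ω)
        (centeredProduct μ f u B h (n + h + 2 + M) ω) ∂μ‖ₑ
      ≤ eLpNorm (centeredProduct μ f u B h n) 2 μ
        * (‖B‖₊ * (eLpNorm (bernoulliShift f u 0) 4 μ * d M
          + (eLpNorm (bernoulliShift f u 0) 4 μ + d M) * d (M + h))) := by
  have hZ2 := memLp_centeredProduct hu hind hid hf hX B h
  have hmean := integral_centeredProduct hu hind hid hf hX B h n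
  have hdiff := eLpNorm_bilin_sub_coupledShift_le hu hind hid hf B h (n + h + 2 + M) M d hd
  have hX4 := memLp_bernoulliShift hu hind hid hf hX
  have hY := memLp_two_bilin B (hX4 (n + h + 2 + M)) (hX4 (n + h + 2 + M + h))
  have hzero := integral_inner_coupledShift_eq_zero hu hind hf B h n M
    (∫ ω, B (bernoulliShift f u 0 ω) (bernoulliShift f u h ω) ∂μ) (hZ2 n) hmean
  set m : ℤ := n + h + 2 + M
  set e : H := ∫ ω, B (bernoulliShift f u 0 ω) (bernoulliShift f u h ω) ∂μ with he
  let Y' : Ω × Ω → H := fun q => B (coupledShift f u m M q) (coupledShift f u (m + h) (M + h) q)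
  have hY'm : AEStronglyMeasurable Y' (μ.prod μ) := B.aestronglyMeasurable_comp₂
    (stronglyMeasurable_coupledShift hu hf m M).aestronglyMeasurable
    (stronglyMeasurable_coupledShift hu hf (m + h) (M + h)).aestronglyMeasurable
  have hYfst : MemLp (fun q : Ω × Ω => B (bernoulliShift f u m q.1)
      (bernoulliShift f u (m + h) q.1)) 2 (μ.prod μ) := hY.comp_fst μ
  have hD : MemLp (fun q : Ω × Ω => B (bernoulliShift f u m q.1)
      (bernoulliShift f u (m + h) q.1) - Y' q) 2 (μ.prod μ) := by
    refine ⟨hYfst.1.sub hY'm, hdiff.trans_lt ?_⟩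
    have h1 := hd_top M
    have h2 := hd_top (M + h)
    have h3 := hX.2.ne
    finiteness
  have hY' : MemLp (fun q => Y' q - e) 2 (μ.prod μ) := by
    refine ((hYfst.sub hD).sub (memLp_const e)).ae_eq (.of_forall fun q => ?_)
    simp
  have hZn : MemLp (fun q : Ω × Ω => centeredProduct μ f u B h n q.1) 2 (μ.prod μ) :=
    (hZ2 n).comp_fst μ
  have hsplit : ∫ ω, inner ℝ (centeredProduct μ f u B h n ω) (centeredProduct μ f u B h m ω) ∂μ
      = ∫ q : Ω × Ω, inner ℝ (centeredProduct μ f u B h n q.1) (B (bernoulliShift f u m q.1)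
        (bernoulliShift f u (m + h) q.1) - Y' q) ∂(μ.prod μ) := by
    have h1 := integral_fun_fst (μ := μ) (ν := μ)
      fun ω => (inner ℝ (centeredProduct μ f u B h n ω) (centeredProduct μ f u B h m ω) : ℝ)
    rw [probReal_univ, one_smul] at h1
    have h2 := integral_add (integrable_inner_of_memLp_two hZn hD)
      (integrable_inner_of_memLp_two hZn hY')
    rw [← h1, ← add_zero (∫ q : Ω × Ω, inner ℝ (centeredProduct μ f u B h n q.1)
      (B (bernoulliShift f u m q.1) (bernoulliShift f u (m + h) q.1) - Y' q) ∂(μ.prod μ)),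
      ← hzero hY']
    refine Eq.trans (integral_congr_ae (.of_forall fun q => ?_)) h2
    simp only [← inner_add_right]
    congr 1
    simp only [centeredProduct, ← he]
    abel
  have hn := eLpNorm_comp_fst (p := 2) (hZ2 n).1
  have hle := enorm_integral_inner_le hZn.1 hD.1
  rw [hn] at hle
  rw [hsplit]
  exact hle.trans (mul_le_mul' le_rfl hdiff)

/-- The covariances of the products `B (X_n, X_{n+h})` of Bernoulli shifts are dominated by a
summable function of the lag. -/
theorem exists_summable_covariance_bound [CompleteSpace H] (hu : ∀ i, Measurable (u i))
    (hind : iIndepFun u μ) (hid : ∀ i j, IdentDistrib (u i) (u j) μ μ)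
    (hf : StronglyMeasurable f) (hX : MemLp (bernoulliShift f u 0) 4 μ)
    (hsum : ∑' M : ℕ, eLpNorm (fun q : Ω × Ω => bernoulliShift f u 0 q.1
      - coupledShift f u 0 M q) 4 (μ.prod μ) < ∞)
    (B : E →L[ℝ] E →L[ℝ] H) (h : ℕ) :
    ∃ c : ℕ → ℝ≥0∞, ∑' k, c k ≠ ∞ ∧
      ∀ n m, ‖∫ ω, inner ℝ (centeredProduct μ f u B h n ω)
        (centeredProduct μ f u B h m ω) ∂μ‖ₑ ≤ c (n - m).natAbs := by
  obtain ⟨d, hd⟩ : ∃ d : ℕ → ℝ≥0∞, ∀ M, d M = eLpNorm (fun q : Ω × Ω =>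
    bernoulliShift f u 0 q.1 - coupledShift f u 0 M q) 4 (μ.prod μ) := ⟨_, fun _ => rfl⟩
  obtain ⟨a, ha, hZa⟩ : ∃ a : ℝ≥0∞, a ≠ ∞ ∧
      ∀ n, eLpNorm (centeredProduct μ f u B h n) 2 μ ≤ a := by
    have h3 := hX.2.ne
    exact ⟨_, by finiteness, eLpNorm_centeredProduct_le hu hind hid hf B h⟩
  obtain ⟨v, hv⟩ : ∃ v, v = eLpNorm (bernoulliShift f u 0) 4 μ := ⟨_, rfl⟩
  have hv_top : v ≠ ∞ := hv ▸ hX.2.ne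
  simp only [← hd] at hsum
  have hdM (M : ℕ) : d M ≤ ∑' M, d M := ENNReal.le_tsum M
  obtain ⟨γ, hγ⟩ : ∃ γ : ℕ → ℝ≥0∞, ∀ M, γ M
      = a * (‖B‖₊ * (v * d M + (v + ∑' M, d M) * d (M + h))) := ⟨_, fun _ => rfl⟩
  have hγ_top : ∑' M, γ M ≠ ∞ := by
    have h1 : ∑' M, d M ≠ ∞ := hsum.ne
    have h2 : ∑' M, d (M + h) ≠ ∞ :=
      ne_top_of_le_ne_top h1 (ENNReal.tsum_comp_le_tsum_of_injective (add_left_injective h) d)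
    simp only [hγ]
    rw [ENNReal.tsum_mul_left, ENNReal.tsum_mul_left, ENNReal.tsum_add, ENNReal.tsum_mul_left,
      ENNReal.tsum_mul_left]
    finiteness
  have hlong (n : ℤ) (M : ℕ) : ‖∫ ω, inner ℝ (centeredProduct μ f u B h n ω)
      (centeredProduct μ f u B h (n + h + 2 + M) ω) ∂μ‖ₑ ≤ γ M := by
    refine (enorm_integral_inner_centeredProduct_le hu hind hid hf hX B h d hd
      (fun M => ne_top_of_le_ne_top hsum.ne (hdM M)) n M).trans ?_
    rw [hγ, ← hv]
    gcongr
    · exact hZa n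
    · exact hdM M
  have hshort (n m : ℤ) : ‖∫ ω, inner ℝ (centeredProduct μ f u B h n ω)
      (centeredProduct μ f u B h m ω) ∂μ‖ₑ ≤ a * a := by
    have hZ := memLp_centeredProduct hu hind hid hf hX B h
    exact (enorm_integral_inner_le (hZ n).1 (hZ m).1).trans (mul_le_mul' (hZa n) (hZa m))
  refine ⟨fun k => if k < h + 2 then a * a else γ (k - (h + 2)), ?_, ?_⟩
  · rw [← Summable.sum_add_tsum_nat_add' (k := h + 2) ENNReal.summable]
    refine ENNReal.add_ne_top.2 ⟨ENNReal.sum_ne_top.2 fun k hk => ?_, ?_⟩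
    · rw [if_pos (Finset.mem_range.1 hk)]
      finiteness
    · simpa using hγ_top
  · have hle (n m : ℤ) (hnm : n ≤ m) : ‖∫ ω, inner ℝ (centeredProduct μ f u B h n ω)
        (centeredProduct μ f u B h m ω) ∂μ‖ₑ
        ≤ if (n - m).natAbs < h + 2 then a * a else γ ((n - m).natAbs - (h + 2)) := by
      split_ifs with hk
      · exact hshort n m
      · obtain ⟨M, hM⟩ : ∃ M, M = (n - m).natAbs - (h + 2) := ⟨_, rfl⟩
        have hm : m = n + h + 2 + M := by omega
        rw [← hM, hm]
        exact hlong n _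
    intro n m
    rcases le_total n m with hnm | hnm
    · exact hle n m hnm
    · have h1 := hle m n hnm
      simp_rw [real_inner_comm (centeredProduct μ f u B h n _)] at h1
      rwa [← Int.natAbs_neg, neg_sub] at h1

/-- Averages of the products `B (X_n, X_{n+h})`, for an `L⁴`-`m`-approximable sequence, converge
to their mean in mean square at the rate `1 / N`. -/
theorem LpmApproximable.exists_lintegral_average_le [CompleteSpace H] {X : ℤ → Ω → E}
    (hX : LpmApproximable.{w} 4 μ X) (B : E →L[ℝ] E →L[ℝ] H) (h : ℕ) :
    ∃ K : ℝ≥0∞, K ≠ ∞ ∧ ∀ N, h < N →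
      ∫⁻ ω, ‖((N : ℝ) - h)⁻¹ • ∑ n ∈ Finset.Icc 1 (N - h), B (X n ω) (X (n + h) ω)
        - ∫ ω, B (X 0 ω) (X h ω) ∂μ‖ₑ ^ 2 ∂μ ≤ K / (N - h : ℕ) := by
  obtain ⟨hmem, U, _, u, f, hu, hind, hid, hf, hXf, hsum⟩ := hX
  have hXf' (n : ℤ) : X n =ᵐ[μ] bernoulliShift f u n := hXf n
  have hd : ∑' M : ℕ, eLpNorm (fun q : Ω × Ω => bernoulliShift f u 0 q.1
      - coupledShift f u 0 M q) 4 (μ.prod μ) < ∞ := by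
    refine lt_of_eq_of_lt (tsum_congr fun M => eLpNorm_congr_ae ?_) (hsum 0)
    filter_upwards [Measure.quasiMeasurePreserving_fst.ae (hXf' 0)] with q hq
    rw [hq]
    rfl
  have hX0 := (memLp_congr_ae (hXf' 0)).1 (hmem 0)
  have hZ := memLp_centeredProduct hu hind hid hf hX0 B h
  obtain ⟨c, hc, hcov⟩ := exists_summable_covariance_bound hu hind hid hf hX0 hd B h
  refine ⟨2 * ∑' k, c k, by finiteness, fun N hN => ?_⟩
  have hL : ((N : ℝ) - h) = ((N - h : ℕ) : ℝ) := by rw [Nat.cast_sub hN.le]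
  have hL0 : ((N - h : ℕ) : ℝ) ≠ 0 := by
    have : N - h ≠ 0 := by omega
    exact_mod_cast this
  have hmean : ∫ ω, B (X 0 ω) (X h ω) ∂μ
      = ∫ ω, B (bernoulliShift f u 0 ω) (bernoulliShift f u h ω) ∂μ := by
    refine integral_congr_ae ?_
    filter_upwards [hXf' 0, hXf' h] with ω h1 h2
    rw [h1, h2]
  have hae : ∀ᵐ ω ∂μ, ∀ n, X n ω = bernoulliShift f u n ω := ae_all_iff.2 hXf'
  have hcong : ∀ᵐ ω ∂μ, ‖((N : ℝ) - h)⁻¹ • ∑ n ∈ Finset.Icc 1 (N - h), B (X n ω) (X (n + h) ω)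
        - ∫ ω, B (X 0 ω) (X h ω) ∂μ‖ₑ ^ 2
      = ‖((N - h : ℕ) : ℝ)⁻¹‖ₑ ^ 2 * ‖∑ n ∈ Finset.Icc 1 (N - h),
        centeredProduct μ f u B h n ω‖ₑ ^ 2 := by
    filter_upwards [hae] with ω hω
    simp only [hω, centeredProduct]
    rw [← mul_pow, ← enorm_smul, hmean, hL, Finset.sum_sub_distrib, Finset.sum_const, Nat.card_Icc,
      Nat.add_sub_cancel, smul_sub, ← Nat.cast_smul_eq_nsmul ℝ, smul_smul, inv_mul_cancel₀ hL0,
      one_smul]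
  rw [lintegral_congr_ae hcong, lintegral_const_mul' _ _ (by finiteness)]
  have hb := lintegral_enorm_sum_sq_le (fun n : ℕ => hZ n) c (fun n m => hcov n m)
    (Finset.Icc 1 (N - h))
  rw [Nat.card_Icc, Nat.add_sub_cancel] at hb
  refine (mul_le_mul_right hb _).trans_eq ?_
  have hL1 : ((N - h : ℕ) : ℝ≥0∞) ≠ 0 := by
    have : N - h ≠ 0 := by omega
    exact_mod_cast this
  rw [enorm_inv hL0, Real.enorm_natCast, ← mul_assoc, sq, mul_assoc (_⁻¹),
    ENNReal.inv_mul_cancel hL1 (by finiteness), mul_one, mul_comm, div_eq_mul_inv]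

end Averages

/-! ### Continuity of the separable part -/

section Panels

variable {S : ℕ}

theorem coordL_apply (s : Fin S) (x : Panel S) : coordL s x = x s := rfl

theorem inclL_eq_single (s : Fin S) (v : L2I) :
    inclL s v = PiLp.single 2 s v := rfl

theorem norm_coordL_le (s : Fin S) : ‖coordL s‖ ≤ 1 :=
  ContinuousLinearMap.opNorm_le_bound _ zero_le_one fun x => by
    rw [one_mul]
    exact PiLp.norm_apply_le x s

theorem norm_inclL_le (s : Fin S) : ‖inclL s‖ ≤ 1 :=
  ContinuousLinearMap.opNorm_le_bound _ zero_le_one fun v => by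
    rw [one_mul, inclL_eq_single, PiLp.norm_single]

theorem IsHilbertSchmidt.block {T : Panel S →L[ℝ] Panel S} (hT : IsHilbertSchmidt T)
    (s s' : Fin S) : IsHilbertSchmidt (block T s s') :=
  hT.comp_comp (norm_coordL_le s) (norm_inclL_le s')

theorem IsHilbertSchmidt.hsNorm_block_le {T : Panel S →L[ℝ] Panel S} (hT : IsHilbertSchmidt T)
    (s s' : Fin S) : hsNorm (SepTest.block T s s') ≤ hsNorm T :=
  hT.hsNorm_comp_comp_le (norm_coordL_le s) (norm_inclL_le s')

theorem IsHilbertSchmidt.partialTrace₁ {T : Panel S →L[ℝ] Panel S} (hT : IsHilbertSchmidt T) :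
    IsHilbertSchmidt (partialTrace₁ T) :=
  .sum fun s _ => hT.block s s

theorem IsHilbertSchmidt.hsNorm_partialTrace₁_le {T : Panel S →L[ℝ] Panel S}
    (hT : IsHilbertSchmidt T) : hsNorm (SepTest.partialTrace₁ T) ≤ S * hsNorm T := by
  refine (hsNorm_sum_le fun s _ => hT.block s s).trans ?_
  refine (Finset.sum_le_sum fun s _ => hT.hsNorm_block_le s s).trans_eq ?_
  simp

theorem IsHilbertSchmidt.tensorOp (A : Matrix (Fin S) (Fin S) ℝ) {B : L2I →L[ℝ] L2I}
    (hB : IsHilbertSchmidt B) : IsHilbertSchmidt (tensorOp A B) :=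
  .sum fun s _ => .sum fun s' _ =>
    (hB.comp_comp (norm_inclL_le s) (norm_coordL_le s')).smul _

theorem IsHilbertSchmidt.hsNorm_tensorOp_le (A : Matrix (Fin S) (Fin S) ℝ) {B : L2I →L[ℝ] L2I}
    (hB : IsHilbertSchmidt B) :
    hsNorm (SepTest.tensorOp A B) ≤ (∑ s, ∑ s', |A s s'|) * hsNorm B := by
  have h (s s' : Fin S) := hB.comp_comp (norm_inclL_le s) (norm_coordL_le s')
  refine (hsNorm_sum_le fun s _ => .sum fun s' _ => (h s s').smul _).trans ?_
  rw [Finset.sum_mul]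
  refine Finset.sum_le_sum fun s _ => (hsNorm_sum_le fun s' _ => (h s s').smul _).trans ?_
  rw [Finset.sum_mul]
  refine Finset.sum_le_sum fun s' _ => ?_
  rw [hsNorm_smul _ (h s s')]
  exact mul_le_mul_of_nonneg_left
    (hB.hsNorm_comp_comp_le (norm_inclL_le s) (norm_coordL_le s')) (abs_nonneg _)

theorem IsHilbertSchmidt.sepPart {T : Panel S →L[ℝ] Panel S} (hT : IsHilbertSchmidt T) :
    IsHilbertSchmidt (sepPart T) :=
  hT.partialTrace₁.tensorOp _

theorem IsHilbertSchmidt.sepDiff {T : Panel S →L[ℝ] Panel S} (hT : IsHilbertSchmidt T) :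
    IsHilbertSchmidt (sepDiff T) :=
  hT.sepPart.sub hT

theorem partialTrace₁_sub (T C : Panel S →L[ℝ] Panel S) :
    partialTrace₁ (T - C) = partialTrace₁ T - partialTrace₁ C := by
  ext1 v
  simp [partialTrace₁, block]

theorem tensorOp_sub_tensorOp (A A' : Matrix (Fin S) (Fin S) ℝ) (B B' : L2I →L[ℝ] L2I) :
    tensorOp A B - tensorOp A' B' = tensorOp (A - A') B + tensorOp A' (B - B') := by
  ext1 x
  ext1 s
  simp only [sub_apply, add_apply, PiLp.sub_apply,
    PiLp.add_apply, tensorOp_apply, Matrix.sub_apply, sub_smul, smul_sub,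
    Finset.sum_sub_distrib]
  abel

/-- The distance between `T` and `C` in the Hilbert–Schmidt norm together with the traces that
enter the separable part; the latter are not continuous in the Hilbert–Schmidt norm alone. -/
noncomputable def traceDist (T C : Panel S →L[ℝ] Panel S) : ℝ :=
  hsNorm (T - C) + |opTrace T - opTrace C|
    + ∑ s, ∑ s', |partialTrace₂ T s s' - partialTrace₂ C s s'|

theorem abs_inv_mul_sub_inv_mul_le {t t₀ a a₀ r : ℝ} (ht₀ : t₀ ≠ 0) (hr : r ≤ |t₀| / 2)
    (ht : |t - t₀| ≤ r) (ha : |a - a₀| ≤ r) :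
    |t⁻¹ * a - t₀⁻¹ * a₀| ≤ 2 * (|t₀| + |a₀|) / |t₀| ^ 2 * r := by
  have hpos : 0 < |t₀| := abs_pos.2 ht₀
  have ht' : |t₀| / 2 ≤ |t| := by
    have := abs_sub_abs_le_abs_sub t₀ t
    rw [abs_sub_comm] at this
    linarith
  have htpos : 0 < |t| := by linarith
  have ht0 : t ≠ 0 := abs_pos.1 htpos
  have e : t⁻¹ * a - t₀⁻¹ * a₀ = ((a - a₀) * t₀ - a₀ * (t - t₀)) / (t * t₀) := by
    field_simp
    ring
  have hnum : |(a - a₀) * t₀ - a₀ * (t - t₀)| ≤ (|t₀| + |a₀|) * r := by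
    refine (abs_sub _ _).trans ?_
    rw [abs_mul, abs_mul]
    have h1 := mul_le_mul_of_nonneg_right ha (abs_nonneg t₀)
    have h2 := mul_le_mul_of_nonneg_left ht (abs_nonneg a₀)
    linarith
  have hr0 : 0 ≤ r := (abs_nonneg _).trans ht
  rw [e, abs_div, abs_mul, div_le_iff₀ (by positivity)]
  refine hnum.trans ?_
  have h3 : |t₀| ^ 2 ≤ 2 * (|t| * |t₀|) := by nlinarith
  calc (|t₀| + |a₀|) * r = (|t₀| + |a₀|) * r / |t₀| ^ 2 * |t₀| ^ 2 := by field_simp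
    _ ≤ (|t₀| + |a₀|) * r / |t₀| ^ 2 * (2 * (|t| * |t₀|)) := by gcongr
    _ = 2 * (|t₀| + |a₀|) / |t₀| ^ 2 * r * (|t| * |t₀|) := by ring

/-- Local Lipschitz continuity, at an operator `C` with nonzero trace, of the squared distance to
the separable part. -/
theorem exists_abs_hsNorm_sepDiff_sq_sub_le {C : Panel S →L[ℝ] Panel S} (hC : IsHilbertSchmidt C)
    (htr : opTrace C ≠ 0) :
    ∃ L η : ℝ, 0 < η ∧ ∀ T : Panel S →L[ℝ] Panel S, IsHilbertSchmidt T → traceDist T C ≤ η →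
      |hsNorm (sepDiff T) ^ 2 - hsNorm (sepDiff C) ^ 2| ≤ L * traceDist T C := by
  set t₀ := opTrace C with ht₀
  set η := |t₀| / 2 with hη
  have hη0 : 0 < η := by have := abs_pos.2 htr; positivity
  set α : ℝ := ∑ s, ∑ s', 2 * (|t₀| + |partialTrace₂ C s s'|) / |t₀| ^ 2 with hα
  have hα0 : 0 ≤ α := Finset.sum_nonneg fun s _ => Finset.sum_nonneg fun s' _ => by positivity
  set β : ℝ := ∑ s, ∑ s', |(t₀⁻¹ • partialTrace₂ C) s s'| with hβ
  have hβ0 : 0 ≤ β := Finset.sum_nonneg fun s _ => Finset.sum_nonneg fun s' _ => abs_nonneg _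
  set κ : ℝ := α * (S * (hsNorm C + η)) + β * S + 1 with hκ
  have hC0 := hsNorm_nonneg C
  have hκ0 : 0 ≤ κ := by positivity
  refine ⟨κ * (κ * η + 2 * hsNorm (sepDiff C)), η, hη0, fun T hT hr => ?_⟩
  set r := traceDist T C with hr_def
  have hTC : hsNorm (T - C) ≤ r := by
    have h1 : 0 ≤ ∑ s, ∑ s', |partialTrace₂ T s s' - partialTrace₂ C s s'| :=
      Finset.sum_nonneg fun s _ => Finset.sum_nonneg fun s' _ => abs_nonneg _
    have h2 := abs_nonneg (opTrace T - opTrace C)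
    simp only [hr_def, traceDist]
    linarith
  have hr0 : 0 ≤ r := (hsNorm_nonneg _).trans hTC
  have htT : |opTrace T - t₀| ≤ r := by
    have h1 : 0 ≤ ∑ s, ∑ s', |partialTrace₂ T s s' - partialTrace₂ C s s'| :=
      Finset.sum_nonneg fun s _ => Finset.sum_nonneg fun s' _ => abs_nonneg _
    have h2 := hsNorm_nonneg (T - C)
    simp only [hr_def, traceDist]
    linarith
  have hptT (s s' : Fin S) : |partialTrace₂ T s s' - partialTrace₂ C s s'| ≤ r := by
    have h1 : |partialTrace₂ T s s' - partialTrace₂ C s s'|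
        ≤ ∑ s, ∑ s', |partialTrace₂ T s s' - partialTrace₂ C s s'| :=
      (Finset.single_le_sum (f := fun s' => |partialTrace₂ T s s' - partialTrace₂ C s s'|)
        (fun _ _ => abs_nonneg _) (Finset.mem_univ s')).trans
        (Finset.single_le_sum (f := fun s => ∑ s', |partialTrace₂ T s s' - partialTrace₂ C s s'|)
          (fun _ _ => Finset.sum_nonneg fun _ _ => abs_nonneg _) (Finset.mem_univ s))
    have h2 := hsNorm_nonneg (T - C)
    have h3 := abs_nonneg (opTrace T - opTrace C)
    simp only [hr_def, traceDist]
    linarith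
  have hmat : ∑ s, ∑ s', |((opTrace T)⁻¹ • partialTrace₂ T - t₀⁻¹ • partialTrace₂ C) s s'|
      ≤ α * r := by
    rw [hα, Finset.sum_mul]
    refine Finset.sum_le_sum fun s _ => ?_
    rw [Finset.sum_mul]
    exact Finset.sum_le_sum fun s' _ => abs_inv_mul_sub_inv_mul_le htr hr htT (hptT s s')
  have hTn : hsNorm T ≤ hsNorm C + η := by
    have := (hT.abs_hsNorm_sub_hsNorm_le hC).trans (hTC.trans hr)
    linarith [le_abs_self (hsNorm T - hsNorm C)]
  have hsub := hT.sub hC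
  have hsep : sepDiff T - sepDiff C
      = tensorOp ((opTrace T)⁻¹ • partialTrace₂ T - t₀⁻¹ • partialTrace₂ C) (partialTrace₁ T)
        + tensorOp (t₀⁻¹ • partialTrace₂ C) (partialTrace₁ (T - C)) - (T - C) := by
    rw [partialTrace₁_sub, ← tensorOp_sub_tensorOp]
    simp only [sepDiff, sepPart, ← ht₀]
    abel
  have hdiff : hsNorm (sepDiff T - sepDiff C) ≤ κ * r := by
    rw [hsep]
    have h1 := (hT.partialTrace₁.tensorOp
      ((opTrace T)⁻¹ • partialTrace₂ T - t₀⁻¹ • partialTrace₂ C))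
    have h2 := (hsub.partialTrace₁.tensorOp (t₀⁻¹ • partialTrace₂ C))
    have h3 := (h1.add h2).hsNorm_sub_le hsub
    have h4 := h1.hsNorm_add_le h2
    have h5 := (hT.partialTrace₁.hsNorm_tensorOp_le
      ((opTrace T)⁻¹ • partialTrace₂ T - t₀⁻¹ • partialTrace₂ C))
    have h6 := (hsub.partialTrace₁.hsNorm_tensorOp_le (t₀⁻¹ • partialTrace₂ C))
    have h7 : hsNorm (SepTest.partialTrace₁ T) ≤ S * (hsNorm C + η) :=
      hT.hsNorm_partialTrace₁_le.trans (by gcongr)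
    have h8 : hsNorm (SepTest.partialTrace₁ (T - C)) ≤ S * r :=
      hsub.hsNorm_partialTrace₁_le.trans (by gcongr)
    have h9 := h5.trans (mul_le_mul hmat h7 (hsNorm_nonneg _) (by positivity))
    have h10 := h6.trans (mul_le_mul_of_nonneg_left h8 hβ0)
    calc _ ≤ α * r * (S * (hsNorm C + η)) + β * (S * r) + r := by linarith
      _ = κ * r := by rw [hκ]; ring
  have habs := (hT.sepDiff.abs_hsNorm_sub_hsNorm_le hC.sepDiff).trans hdiff
  have hx := hsNorm_nonneg (SepTest.sepDiff T)
  have hy := hsNorm_nonneg (SepTest.sepDiff C)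
  have hκr : κ * r ≤ κ * η := by gcongr
  have hxy : hsNorm (SepTest.sepDiff T) ≤ κ * η + hsNorm (SepTest.sepDiff C) := by
    linarith [le_abs_self (hsNorm (SepTest.sepDiff T) - hsNorm (SepTest.sepDiff C))]
  rw [sq_sub_sq, abs_mul, abs_of_nonneg (add_nonneg hx hy)]
  calc _ ≤ (κ * η + 2 * hsNorm (SepTest.sepDiff C)) * (κ * r) := by
        refine mul_le_mul (by linarith) habs (abs_nonneg _) (by positivity)
    _ = _ := by ring

end Panels

/-! ### Boundedness in probability -/

section BigOP

variable {Ω : Type*} [MeasurableSpace Ω] {μ : Measure Ω}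

theorem IsBigOP.zero (a : ℕ → ℝ) : IsBigOP μ (fun _ _ => 0) a := fun ε _ =>
  ⟨0, .of_forall fun N => by simp⟩

theorem IsBigOP.add {Y Z : ℕ → Ω → ℝ} {a : ℕ → ℝ} (hY : IsBigOP μ Y a) (hZ : IsBigOP μ Z a) :
    IsBigOP μ (fun N ω => Y N ω + Z N ω) a := by
  intro ε hε
  obtain ⟨K, hK⟩ := hY (ε / 2) (ENNReal.half_pos hε.ne')
  obtain ⟨K', hK'⟩ := hZ (ε / 2) (ENNReal.half_pos hε.ne')
  refine ⟨K + K', ?_⟩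
  filter_upwards [hK, hK'] with N h1 h2
  calc μ {ω | (K + K') * a N < |Y N ω + Z N ω|}
      ≤ μ ({ω | K * a N < |Y N ω|} ∪ {ω | K' * a N < |Z N ω|}) := by
        refine measure_mono fun ω hω => ?_
        by_contra hcon
        simp only [Set.mem_union, Set.mem_ofPred_eq, not_or, not_lt] at hω hcon
        have := abs_add_le (Y N ω) (Z N ω)
        linarith
    _ ≤ ε / 2 + ε / 2 := (measure_union_le _ _).trans (add_le_add h1 h2)
    _ = ε := ENNReal.add_halves ε

theorem IsBigOP.sum {ι : Type*} (s : Finset ι) {Y : ι → ℕ → Ω → ℝ} {a : ℕ → ℝ}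
    (hY : ∀ i ∈ s, IsBigOP μ (Y i) a) : IsBigOP μ (fun N ω => ∑ i ∈ s, Y i N ω) a := by
  classical
  induction s using Finset.induction_on with
  | empty => simpa using IsBigOP.zero a
  | insert i s hi ih =>
    simp only [Finset.sum_insert hi]
    exact (hY i (Finset.mem_insert_self i s)).add
      (ih fun j hj => hY j (Finset.mem_insert_of_mem hj))

/-- Chebyshev's inequality, in the form: a mean square rate `1 / N` gives the rate `N^{-1/2}` in
probability. -/
theorem isBigOP_sqrt_mul_norm {H : Type*} [NormedAddCommGroup H] {W : ℕ → Ω → H}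
    (hW : ∀ N, AEStronglyMeasurable (W N) μ) (h : ℕ) {K : ℝ≥0∞} (hK : K ≠ ∞)
    (hb : ∀ N, h < N → ∫⁻ ω, ‖W N ω‖ₑ ^ 2 ∂μ ≤ K / (N - h : ℕ)) :
    IsBigOP μ (fun N ω => √(N : ℝ) * ‖W N ω‖) (fun _ => 1) := by
  intro ε hε
  -- `C` is chosen so that `2 K ≤ ε C²`
  obtain ⟨C, hC0, hC⟩ : ∃ C : ℝ, 0 < C ∧ 2 * K ≤ ε * ENNReal.ofReal C ^ 2 := by
    have hfin : 2 * K / ε ≠ ∞ := ENNReal.div_ne_top (by finiteness) hε.ne'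
    refine ⟨√(2 * K / ε).toReal + 1, by positivity, ?_⟩
    have h1 : (2 * K / ε).toReal ≤ (√(2 * K / ε).toReal + 1) ^ 2 := by
      have h2 := Real.sq_sqrt (ENNReal.toReal_nonneg (a := 2 * K / ε))
      have h3 := Real.sqrt_nonneg (2 * K / ε).toReal
      nlinarith
    rw [← ENNReal.ofReal_pow (by positivity), mul_comm ε]
    rcases eq_or_ne ε ∞ with rfl | hε_top
    · rw [ENNReal.mul_top (by simp)]
      exact le_top
    · rw [← ENNReal.div_le_iff hε.ne' hε_top]
      exact (ENNReal.ofReal_toReal hfin).symm.le.trans (ENNReal.ofReal_le_ofReal h1)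
  refine ⟨C, ?_⟩
  filter_upwards [eventually_ge_atTop (2 * h + 1)] with N hN
  have hC1 : ENNReal.ofReal C ^ 2 ≠ 0 := by
    simpa using hC0
  have hsub : {ω | C * 1 < |√(N : ℝ) * ‖W N ω‖|}
      ⊆ {ω | ENNReal.ofReal C ^ 2 ≤ N * ‖W N ω‖ₑ ^ 2} := by
    intro ω hω
    simp only [Set.mem_ofPred_eq, mul_one] at hω ⊢
    rw [abs_of_nonneg (by positivity)] at hω
    have h1 : C ^ 2 ≤ N * ‖W N ω‖ ^ 2 := by
      have h2 := pow_le_pow_left₀ hC0.le hω.le 2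
      rwa [mul_pow, Real.sq_sqrt (Nat.cast_nonneg N)] at h2
    have h3 := ENNReal.ofReal_le_ofReal h1
    rwa [ENNReal.ofReal_pow hC0.le, ENNReal.ofReal_mul (Nat.cast_nonneg N),
      ENNReal.ofReal_pow (norm_nonneg _), ofReal_norm, ENNReal.ofReal_natCast] at h3
  have hmeas : AEMeasurable (fun ω => (N : ℝ≥0∞) * ‖W N ω‖ₑ ^ 2) μ :=
    ((hW N).enorm.pow_const 2).const_mul _
  have hmarkov := mul_meas_ge_le_lintegral₀ hmeas (ENNReal.ofReal C ^ 2)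
  rw [lintegral_const_mul' _ _ (by finiteness)] at hmarkov
  have hNh : (N : ℝ≥0∞) ≤ 2 * (N - h : ℕ) := by
    have : N ≤ 2 * (N - h) := by omega
    exact_mod_cast this
  have hL1 : ((N - h : ℕ) : ℝ≥0∞) ≠ 0 := by
    have : N - h ≠ 0 := by omega
    exact_mod_cast this
  have hle : ENNReal.ofReal C ^ 2 * μ {ω | C * 1 < |√(N : ℝ) * ‖W N ω‖|}
      ≤ ENNReal.ofReal C ^ 2 * ε := by
    calc _ ≤ ENNReal.ofReal C ^ 2 * μ {ω | ENNReal.ofReal C ^ 2 ≤ N * ‖W N ω‖ₑ ^ 2} := by gcongr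
      _ ≤ N * ∫⁻ ω, ‖W N ω‖ₑ ^ 2 ∂μ := hmarkov
      _ ≤ 2 * (N - h : ℕ) * (K / (N - h : ℕ)) := mul_le_mul' hNh (hb N (by omega))
      _ = 2 * K := by
        rw [mul_assoc, ENNReal.mul_div_cancel hL1 (by finiteness)]
      _ ≤ ENNReal.ofReal C ^ 2 * ε := hC.trans_eq (mul_comm _ _)
  exact (ENNReal.mul_le_mul_iff_right hC1 (by finiteness)).1 hle

/-- A statistic of size `N δ + O_P(√N)`, with `δ > 0`, tends to infinity in probability. -/
theorem IsBigOP.tendstoInftyInProbability {Y : ℕ → Ω → ℝ} {δ : ℝ} (hδ : 0 < δ)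
    (hY : IsBigOP μ (fun N ω => Y N ω - N * δ) fun N => √(N : ℝ)) :
    TendstoInftyInProbability μ Y := by
  intro K
  rw [ENNReal.tendsto_nhds_zero]
  intro ε hε
  obtain ⟨C, hC⟩ := hY ε hε
  have hsqrt : Tendsto (fun N : ℕ => √(N : ℝ)) atTop atTop :=
    Real.tendsto_sqrt_atTop.comp tendsto_natCast_atTop_atTop
  have hlim : Tendsto (fun N : ℕ => √(N : ℝ) * (√(N : ℝ) * δ - C)) atTop atTop :=
    hsqrt.atTop_mul_atTop₀ (tendsto_atTop_add_const_right _ _ (hsqrt.atTop_mul_const hδ))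
  filter_upwards [hC, hlim.eventually_gt_atTop K] with N h1 h2
  refine (measure_mono fun ω hω => ?_).trans h1
  simp only [Set.mem_ofPred_eq] at hω ⊢
  have h3 : (N : ℝ) = √(N : ℝ) * √(N : ℝ) := (Real.mul_self_sqrt (Nat.cast_nonneg N)).symm
  have h4 : √(N : ℝ) * (√(N : ℝ) * δ - C) = N * δ - C * √(N : ℝ) := by
    rw [mul_sub, ← mul_assoc, ← h3, mul_comm C]
  have h5 := neg_abs_le (Y N ω - N * δ)
  linarith

/-- A test based on a statistic that tends to infinity in probability is consistent for critical
values that are bounded in probability. -/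
theorem TendstoInftyInProbability.tendsto_measure_lt [IsProbabilityMeasure μ] {Y q : ℕ → Ω → ℝ}
    (hY : TendstoInftyInProbability μ Y) (hq : IsBigOP μ q fun _ => 1) :
    Tendsto (fun N => μ {ω | q N ω < Y N ω}) atTop (𝓝 1) := by
  rw [ENNReal.tendsto_nhds (by simp)]
  intro ε hε
  obtain ⟨K, hK⟩ := hq (ε / 2) (ENNReal.half_pos hε.ne')
  filter_upwards [hK, ENNReal.tendsto_nhds_zero.1 (hY K) (ε / 2) (ENNReal.half_pos hε.ne')]
    with N h1 h2
  refine ⟨?_, prob_le_one.trans le_self_add⟩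
  rw [tsub_le_iff_right]
  have hcover : (Set.univ : Set Ω) ⊆ {ω | q N ω < Y N ω}
      ∪ ({ω | K * 1 < |q N ω|} ∪ {ω | Y N ω ≤ K}) := by
    intro ω _
    by_contra hcon
    simp only [Set.mem_union, Set.mem_ofPred_eq, not_or, not_lt, not_le] at hcon
    have := le_abs_self (q N ω)
    linarith
  calc (1 : ℝ≥0∞) = μ Set.univ := measure_univ.symm
    _ ≤ μ {ω | q N ω < Y N ω} + (μ {ω | K * 1 < |q N ω|} + μ {ω | Y N ω ≤ K}) :=
      (measure_mono hcover).trans ((measure_union_le _ _).trans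
        (add_le_add le_rfl (measure_union_le _ _)))
    _ ≤ μ {ω | q N ω < Y N ω} + (ε / 2 + ε / 2) := by gcongr
    _ = μ {ω | q N ω < Y N ω} + ε := by rw [ENNReal.add_halves]

end BigOP

/-! ### The lag covariance operator and its estimator -/

section LagCovariance

variable {S : ℕ} {Ω : Type*} [MeasurableSpace Ω] {μ : Measure Ω}

section Inner

variable (E : Type*) [NormedAddCommGroup E] [InnerProductSpace ℝ E]

/-- The inner product of a real Hilbert space as a bounded bilinear map. -/
noncomputable def innerBilin : E →L[ℝ] E →L[ℝ] ℝ :=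
  LinearMap.mkContinuous₂ (innerₗ E) 1 fun x y => by
    rw [one_mul]
    exact norm_inner_le_norm (𝕜 := ℝ) x y

end Inner

theorem opTrace_smul_sum_rankOne {E : Type*} [NormedAddCommGroup E] [InnerProductSpace ℝ E]
    [CompleteSpace E] {ι : Type*} (c : ℝ) (s : Finset ι) (x y : ι → E) :
    opTrace (c • ∑ n ∈ s, InnerProductSpace.rankOne ℝ (x n) (y n))
      = c • ∑ n ∈ s, inner ℝ (x n) (y n) := by
  have h (n : ι) : HasSum
      (fun i => inner ℝ (InnerProductSpace.rankOne ℝ (x n) (y n) (onb E i)) (onb E i))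
      (inner ℝ (x n) (y n) : ℝ) := by
    refine ((onb E).hasSum_inner_mul_inner (x n) (y n)).congr_fun fun i => ?_
    rw [InnerProductSpace.rankOne_apply, real_inner_smul_left, mul_comm, real_inner_comm (y n)]
  have hs := (hasSum_sum fun n (_ : n ∈ s) => h n).const_smul c
  rw [opTrace, ← hs.tsum_eq]
  refine tsum_congr fun i => ?_
  simp [inner_smul_left, sum_inner, Finset.mul_sum]

theorem block_rankOne (x y : Panel S) (s s' : Fin S) :
    block (InnerProductSpace.rankOne ℝ x y) s s' = InnerProductSpace.rankOne ℝ (x s) (y s') := by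
  ext1 v
  have h : (inner ℝ y (inclL s' v) : ℝ) = inner ℝ (y s') v := by
    rw [PiLp.inner_apply, Finset.sum_eq_single s'] <;>
      simp +contextual [inclL_eq_single]
  simp [block, coordL_apply, h]

theorem block_smul_sum {ι : Type*} (c : ℝ) (F : Finset ι) (T : ι → Panel S →L[ℝ] Panel S)
    (s s' : Fin S) : block (c • ∑ n ∈ F, T n) s s' = c • ∑ n ∈ F, block (T n) s s' := by
  ext1 v
  simp [block]

theorem memLp_coord {X : Ω → Panel S} {p : ℝ≥0∞} (hX : MemLp X p μ) (s : Fin S) :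
    MemLp (fun ω => X ω s) p μ :=
  (coordL s).comp_memLp' hX

theorem block_integral_rankOne [IsFiniteMeasure μ] {X Y : Ω → Panel S} (hX : MemLp X 4 μ)
    (hY : MemLp Y 4 μ) (s s' : Fin S) :
    block (∫ ω, InnerProductSpace.rankOne ℝ (X ω) (Y ω) ∂μ) s s'
      = ∫ ω, InnerProductSpace.rankOne ℝ (X ω s) (Y ω s') ∂μ := by
  ext1 v
  have hr := integrable_rankOne hX hY
  rw [ContinuousLinearMap.integral_apply
    (integrable_rankOne (memLp_coord hX s) (memLp_coord hY s'))]
  have h : block (∫ ω, InnerProductSpace.rankOne ℝ (X ω) (Y ω) ∂μ) s s' v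
      = coordL s ((∫ ω, InnerProductSpace.rankOne ℝ (X ω) (Y ω) ∂μ) (inclL s' v)) := rfl
  rw [h, ContinuousLinearMap.integral_apply hr,
    ← (coordL s).integral_comp_comm (hr.apply_continuousLinearMap _)]
  refine integral_congr_ae (.of_forall fun ω => ?_)
  exact congrArg (fun T : L2I →L[ℝ] L2I => T v) (block_rankOne (X ω) (Y ω) s s')

variable {X : ℤ → Ω → Panel S}

theorem isHilbertSchmidt_lagCov [IsFiniteMeasure μ] (hX : ∀ n, MemLp (X n) 4 μ) (h : ℕ) :
    IsHilbertSchmidt (lagCov μ X h) :=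
  isHilbertSchmidt_of_apply (integral_rankOneHS_apply (hX 0) (hX h))

omit [MeasurableSpace Ω] in
theorem isHilbertSchmidt_lagCovHat (X : ℤ → Ω → Panel S) (h N : ℕ) (ω : Ω) :
    IsHilbertSchmidt (lagCovHat X h N ω) :=
  .smul _ (.sum fun _ _ => isHilbertSchmidt_rankOne _ _)

theorem hsNorm_lagCovHat_sub_lagCov [IsFiniteMeasure μ] (hX : ∀ n, MemLp (X n) 4 μ) (h N : ℕ)
    (ω : Ω) : hsNorm (lagCovHat X h N ω - lagCov μ X h)
      = ‖((N : ℝ) - h)⁻¹ • ∑ n ∈ Finset.Icc 1 (N - h), rankOneHS (Panel S) (X n ω) (X (n + h) ω)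
        - ∫ ω, rankOneHS (Panel S) (X 0 ω) (X h ω) ∂μ‖ := by
  refine hsNorm_eq_norm_of_apply fun i => ?_
  rw [lp.coeFn_sub, Pi.sub_apply, integral_rankOneHS_apply (hX 0) (hX h), lp.coeFn_smul,
    Pi.smul_apply, lp.coeFn_sum, Finset.sum_apply]
  simp [lagCovHat, lagCov, rankOneHS_apply]

theorem opTrace_lagCovHat_sub_lagCov [IsFiniteMeasure μ] (hX : ∀ n, MemLp (X n) 4 μ) (h N : ℕ)
    (ω : Ω) : opTrace (lagCovHat X h N ω) - opTrace (lagCov μ X h)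
      = ((N : ℝ) - h)⁻¹ • ∑ n ∈ Finset.Icc 1 (N - h), innerBilin (Panel S) (X n ω) (X (n + h) ω)
        - ∫ ω, innerBilin (Panel S) (X 0 ω) (X h ω) ∂μ := by
  rw [lagCovHat, opTrace_smul_sum_rankOne, lagCov, opTrace_integral_rankOne (hX 0) (hX h)]
  rfl

theorem partialTrace₂_lagCovHat_sub_lagCov [IsFiniteMeasure μ] (hX : ∀ n, MemLp (X n) 4 μ)
    (h N : ℕ) (ω : Ω) (s s' : Fin S) :
    partialTrace₂ (lagCovHat X h N ω) s s' - partialTrace₂ (lagCov μ X h) s s'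
      = ((N : ℝ) - h)⁻¹ • ∑ n ∈ Finset.Icc 1 (N - h),
          (innerBilin L2I).bilinearComp (coordL s) (coordL s') (X n ω) (X (n + h) ω)
        - ∫ ω, (innerBilin L2I).bilinearComp (coordL s) (coordL s') (X 0 ω) (X h ω) ∂μ := by
  rw [partialTrace₂, partialTrace₂, Matrix.of_apply, Matrix.of_apply, lagCovHat, block_smul_sum,
    lagCov, block_integral_rankOne (hX 0) (hX h),
    opTrace_integral_rankOne (memLp_coord (hX 0) s) (memLp_coord (hX h) s')]
  simp only [block_rankOne]
  rw [opTrace_smul_sum_rankOne]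
  rfl

theorem LpmApproximable.isBigOP_sqrt_mul_norm_average [IsProbabilityMeasure μ] {E H : Type*}
    [NormedAddCommGroup E] [NormedSpace ℝ E] [NormedAddCommGroup H] [InnerProductSpace ℝ H]
    [CompleteSpace H] {X : ℤ → Ω → E} (hX : LpmApproximable.{w} 4 μ X) (B : E →L[ℝ] E →L[ℝ] H)
    (h : ℕ) : IsBigOP μ (fun N ω => √(N : ℝ) *
      ‖((N : ℝ) - h)⁻¹ • ∑ n ∈ Finset.Icc 1 (N - h), B (X n ω) (X (n + h) ω)
        - ∫ ω, B (X 0 ω) (X h ω) ∂μ‖) (fun _ => 1) := by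
  obtain ⟨K, hK, hb⟩ := hX.exists_lintegral_average_le B h
  refine isBigOP_sqrt_mul_norm (fun N => ?_) h hK hb
  refine AEStronglyMeasurable.sub (AEStronglyMeasurable.const_smul
    (Finset.aestronglyMeasurable_fun_sum _ fun n _ => ?_) _) aestronglyMeasurable_const
  exact B.aestronglyMeasurable_comp₂ (hX.1 _).1 (hX.1 _).1

theorem LpmApproximable.isBigOP_sqrt_mul_traceDist [IsProbabilityMeasure μ]
    (hX : LpmApproximable.{w} 4 μ X) (h : ℕ) :
    IsBigOP μ (fun N ω => √(N : ℝ) * traceDist (lagCovHat X h N ω) (lagCov μ X h))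
      (fun _ => 1) := by
  have h1 := hX.isBigOP_sqrt_mul_norm_average (rankOneHS (Panel S)) h
  have h2 := hX.isBigOP_sqrt_mul_norm_average (innerBilin (Panel S)) h
  have h3 (s s' : Fin S) := hX.isBigOP_sqrt_mul_norm_average
    ((innerBilin L2I).bilinearComp (coordL s) (coordL s')) h
  simp only [← hsNorm_lagCovHat_sub_lagCov hX.1] at h1
  simp only [← opTrace_lagCovHat_sub_lagCov hX.1, Real.norm_eq_abs] at h2
  simp only [← partialTrace₂_lagCovHat_sub_lagCov hX.1, Real.norm_eq_abs] at h3
  have h4 := (h1.add h2).add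
    (IsBigOP.sum Finset.univ fun s _ => IsBigOP.sum Finset.univ fun s' _ => h3 s s')
  simpa only [traceDist, mul_add, Finset.mul_sum] using h4

/-- The expansion `T̂ = N ‖Δ‖² + O_P(√N)`. -/
theorem LpmApproximable.isBigOP_testStat_sub [IsProbabilityMeasure μ]
    (hX : LpmApproximable.{w} 4 μ X) (h : ℕ) (htr : opTrace (lagCov μ X h) ≠ 0) :
    IsBigOP μ (fun N ω => testStat X h N ω - N * hsNorm (sepDiff (lagCov μ X h)) ^ 2)
      (fun N => √(N : ℝ)) := by
  obtain ⟨L, η, hη, hL⟩ := exists_abs_hsNorm_sepDiff_sq_sub_le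
    (isHilbertSchmidt_lagCov hX.1 h) htr
  intro ε hε
  obtain ⟨K, hK⟩ := hX.isBigOP_sqrt_mul_traceDist h ε hε
  refine ⟨|L| * K, ?_⟩
  have hsqrt : Tendsto (fun N : ℕ => √(N : ℝ)) atTop atTop :=
    Real.tendsto_sqrt_atTop.comp tendsto_natCast_atTop_atTop
  filter_upwards [hK, (hsqrt.atTop_mul_const hη).eventually_ge_atTop K,
    eventually_gt_atTop 0] with N h1 h2 hN
  refine (measure_mono fun ω hω => ?_).trans h1
  by_contra hcon
  simp only [Set.mem_ofPred_eq, not_lt, mul_one] at hω hcon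
  refine absurd hω (not_lt.2 ?_)
  have hNpos : 0 < √(N : ℝ) := Real.sqrt_pos.2 (by exact_mod_cast hN)
  set r := traceDist (lagCovHat X h N ω) (lagCov μ X h) with hr
  have hrK : √(N : ℝ) * r ≤ K := (le_abs_self _).trans hcon
  have hr0 : 0 ≤ r := by
    have h1 := hsNorm_nonneg (lagCovHat X h N ω - lagCov μ X h)
    rw [hr, traceDist]
    positivity
  have hrη : r ≤ η := le_of_mul_le_mul_left (hrK.trans h2) hNpos
  have h3 := hL _ (isHilbertSchmidt_lagCovHat X h N ω) hrη
  rw [testStat, ← mul_sub, abs_mul, Nat.abs_cast]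
  have h4 : (N : ℝ) = √(N : ℝ) * √(N : ℝ) := (Real.mul_self_sqrt (Nat.cast_nonneg N)).symm
  calc _ ≤ (N : ℝ) * (|L| * r) := by
        refine mul_le_mul_of_nonneg_left (h3.trans ?_) (Nat.cast_nonneg N)
        exact mul_le_mul_of_nonneg_right (le_abs_self L) hr0
    _ = |L| * (√(N : ℝ) * r) * √(N : ℝ) := by
        rw [h4]
        simp only [Real.sqrt_mul_self hNpos.le]
        ring
    _ ≤ |L| * K * √(N : ℝ) := by gcongr

end LagCovariance

end SepTest

open SepTest
theorem theorem4 {Ω : Type*} [MeasurableSpace Ω] (μ : Measure Ω) [IsProbabilityMeasure μ]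
    (S h : ℕ) (X : ℤ → Ω → Panel S)
    (hX : LpmApproximable.{w} 4 μ X)
    (hmean : ∀ n, ∫ ω, X n ω ∂μ = 0)
    (htr : opTrace (lagCov μ X h) ≠ 0)
    (hA : sepDiff (lagCov μ X h) ≠ 0) :
    (IsHilbertSchmidt (sepDiff (lagCov μ X h)) ∧
      ∀ N ω, IsHilbertSchmidt (sepDiff (lagCovHat X h N ω))) ∧
    IsBigOP μ (fun N ω => testStat X h N ω - N * hsNorm (sepDiff (lagCov μ X h)) ^ 2)
      (fun N => √(N : ℝ)) ∧
    TendstoInftyInProbability μ (testStat X h) ∧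
    ∀ q : ℕ → Ω → ℝ, IsBigOP μ q (fun _ => 1) →
      Tendsto (fun N => μ {ω | q N ω < testStat X h N ω}) atTop (𝓝 1) := by
  have hΔ : IsHilbertSchmidt (sepDiff (lagCov μ X h)) := (isHilbertSchmidt_lagCov hX.1 h).sepDiff
  have hexp := hX.isBigOP_testStat_sub h htr
  have hinf := hexp.tendstoInftyInProbability (pow_pos (hΔ.hsNorm_pos hA) 2)
  exact ⟨⟨hΔ, fun N ω => (isHilbertSchmidt_lagCovHat X h N ω).sepDiff⟩, hexp, hinf,
    fun q hq => hinf.tendsto_measure_lt hq⟩
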